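/- A permutation is a bijection $\pi$ of $[n]=\{1,\dots,n\}$, $n\ge 0$ (the empty permutation is allowed). The pattern of a set of elements (points $(i,\pi(i))$) of $\pi$ is the permutation with the same relative order of positions and of values. A permutation $\sigma$ is contained in $\pi$ if it is the pattern of some set of elements of $\pi$. A permutation class is a set of permutations that is closed downwards under containment, and $\mathrm{Av}(\sigma)$ is the class of all permutations not containing $\sigma$. A proper subclass of a class $\mathcal C$ is a permutation class strictly contained in $\mathcal C$. The sum $\sigma\oplus\tau$ (the skew sum $\sigma\ominus\tau$) places a copy of $\tau$ above (below) and to the right of a copy of $\sigma$. The class $\mathsf{Sep}$ of separable permutations consists of the permutations that can be built from the empty permutation and the permutation $1$ by sums and skew sums. The merge $\mathcal C\odot\mathcal D$ of two classes is the set of permutations whose elements can be partitioned into two sets, one with pattern in $\mathcal C$ and the other with pattern in $\mathcal D$. A class $\mathcal C$ is splittable if there are $k\ge 1$ and proper subclasses $\mathcal C_1,\dots,\mathcal C_k$ of $\mathcal C$ with $\mathcal C\subseteq\mathcal C_1\odot\cdots\odot\mathcal C_k$, and unsplittable otherwise. The inflation $\sigma[\tau_1,\dots,\tau_k]$ of a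 permutation $\sigma$ of size $k$ is obtained from $\sigma$ by replacing its $i$-th element, for each $i$, by an interval (a set of elements contiguous in position and in value) with pattern $\tau_i$, the relative order of distinct intervals being that of the elements that they replace. For classes $\mathcal C,\mathcal D$, let $\mathcal C[\mathcal D]$ be the set of all $\sigma[\tau_1,\dots,\tau_k]$ with $\sigma\in\mathcal C$ of any size $k$ and $\tau_1,\dots,\tau_k\in\mathcal D$. Let $\mathsf I$ and $\mathsf D$ be the classes of increasing and of decreasing permutations, and let $\mathcal A=\{\mathsf I,\mathsf D,\mathrm{Av}(213),\mathrm{Av}(312),\mathrm{Av}(132),\mathrm{Av}(231)\}$. A class is representable if it is an iterated inflation $\mathcal X_1[\mathcal X_2[\cdots[\mathcal X_m]\cdots]]$ of a finite sequence of classes $\mathcal X_1,\dots,\mathcal X_m\in\mathcal A$, $m\ge 0$, where $m=0$ gives the class whose only members are the permutation $1$ and the empty permutation. Theorem. Let $\mathcal X$ be a proper subclass of $\mathsf{Sep}$ that contains the permutation $1$. Then $\mathcal X$ is unsplittable if and only if it is representable. -/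

import Mathlib

namespace PermSplit

/-- A permutation of some size `n ≥ 0` (positions and values are numbered from `0`); the empty
permutation is included. -/
abbrev Permutation : Type := Σ n : ℕ, Equiv.Perm (Fin n)

/-- `σ` is the pattern of the elements of `π` at the positions in `S`. -/
def IsPatternOf (σ π : Permutation) (S : Set (Fin π.1)) : Prop :=
  ∃ f : Fin σ.1 ↪o Fin π.1, Set.range f = S ∧
    ∀ i j, σ.2 i < σ.2 j ↔ π.2 (f i) < π.2 (f j)

/-- `σ` is contained in `π`. -/
def Contained (σ π : Permutation) : Prop :=
  ∃ S : Set (Fin π.1), IsPatternOf σ π S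

/-- Permutation classes: sets of permutations closed downwards under containment. -/
def IsPermClass (C : Set Permutation) : Prop :=
  ∀ π ∈ C, ∀ σ, Contained σ π → σ ∈ C

/-- The class `Av(π)` of the permutations that avoid `π`. -/
def Av (π : Permutation) : Set Permutation := {ρ | ¬ Contained π ρ}

/-- The empty permutation. -/
def emptyPerm : Permutation := ⟨0, Equiv.refl _⟩

/-- The permutation `1` of size one. -/
def onePerm : Permutation := ⟨1, Equiv.refl _⟩

/-- The permutation `132`. -/
def perm132 : Permutation := ⟨3, ⟨![0, 2, 1], ![0, 2, 1], by decide, by decide⟩⟩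

/-- The permutation `213`. -/
def perm213 : Permutation := ⟨3, ⟨![1, 0, 2], ![1, 0, 2], by decide, by decide⟩⟩

/-- The permutation `231`. -/
def perm231 : Permutation := ⟨3, ⟨![1, 2, 0], ![2, 0, 1], by decide, by decide⟩⟩

/-- The permutation `312`. -/
def perm312 : Permutation := ⟨3, ⟨![2, 0, 1], ![1, 2, 0], by decide, by decide⟩⟩

/-- The sum `σ ⊕ τ`: a copy of `τ` above and to the right of a copy of `σ`. -/
def dirSum (σ τ : Permutation) : Permutation :=
  ⟨σ.1 + τ.1,
    finSumFinEquiv.symm.trans ((Equiv.sumCongr σ.2 τ.2).trans finSumFinEquiv)⟩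

/-- The skew sum `σ ⊖ τ`: a copy of `τ` below and to the right of a copy of `σ`. -/
def skewSum (σ τ : Permutation) : Permutation :=
  ⟨σ.1 + τ.1,
    finSumFinEquiv.symm.trans ((Equiv.sumCongr σ.2 τ.2).trans
      ((Equiv.sumComm (Fin σ.1) (Fin τ.1)).trans
        (finSumFinEquiv.trans (finCongr (Nat.add_comm τ.1 σ.1)))))⟩

/-- Separable permutations: those built from the empty permutation and `1` by sums and skew
sums. -/
inductive IsSeparable : Permutation → Prop
  | empty : IsSeparable emptyPerm
  | one : IsSeparable onePerm
  | sum (σ τ : Permutation) : IsSeparable σ → IsSeparable τ → IsSeparable (dirSum σ τ)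
  | skew (σ τ : Permutation) : IsSeparable σ → IsSeparable τ → IsSeparable (skewSum σ τ)

/-- The class of separable permutations. -/
def Sep : Set Permutation := {π | IsSeparable π}

/-- `π = σ[τ 0, τ 1, …]`. The map `b` sends each position of `π` to the position of `σ` whose
inflation it belongs to. As `b` is monotone the blocks are consecutive, the `i`-th block has
pattern `τ i` (it is empty if `τ i` is), and elements of distinct blocks compare as in `σ`. -/
def IsInflation (π σ : Permutation) (τ : Fin σ.1 → Permutation) : Prop :=
  ∃ b : Fin π.1 → Fin σ.1, Monotone b ∧
    (∀ i, IsPatternOf (τ i) π (b ⁻¹' {i})) ∧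
    ∀ x y, b x ≠ b y → (π.2 x < π.2 y ↔ σ.2 (b x) < σ.2 (b y))

/-- The inflation `C[D]`: all inflations of a permutation from `C` by permutations from `D`. -/
def inflate (C D : Set Permutation) : Set Permutation :=
  {π | ∃ σ ∈ C, ∃ τ : Fin σ.1 → Permutation, (∀ i, τ i ∈ D) ∧ IsInflation π σ τ}

/-- The merge `C ⊙ D`: the permutations whose elements can be partitioned into two sets, one with
pattern in `C` and the other with pattern in `D`. -/
def merge (C D : Set Permutation) : Set Permutation :=
  {π | ∃ S : Set (Fin π.1), ∃ σ ∈ C, ∃ τ ∈ D, IsPatternOf σ π S ∧ IsPatternOf τ π Sᶜ}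

/-- The merge of a finite sequence of classes; `{emptyPerm}` is the unit for merging. -/
def mergeList : List (Set Permutation) → Set Permutation
  | [] => {emptyPerm}
  | C :: L => merge C (mergeList L)

/-- `C` is contained in the merge of a (non-empty) finite sequence of proper subclasses of `C`. -/
def Splittable (C : Set Permutation) : Prop :=
  ∃ L : List (Set Permutation), L ≠ [] ∧ (∀ D ∈ L, IsPermClass D ∧ D ⊂ C) ∧ C ⊆ mergeList L

/-- The class consisting of the permutation `1` and the empty permutation. -/
def classUnit : Set Permutation := {emptyPerm, onePerm}

/-- The class of increasing permutations. -/
def classI : Set Permutation := {π | StrictMono π.2}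

/-- The class of decreasing permutations. -/
def classD : Set Permutation := {π | StrictAnti π.2}

/-- The alphabet for words that describe iterated inflations. -/
inductive Letter
  | I
  | D
  | av213
  | av312
  | av132
  | av231

/-- The class denoted by a letter. -/
def Letter.toClass : Letter → Set Permutation
  | .I => classI
  | .D => classD
  | .av213 => Av perm213
  | .av312 => Av perm312
  | .av132 => Av perm132
  | .av231 => Av perm231

/-- The class represented by a word: the iterated inflation of the classes of its letters. The
empty word represents `classUnit`, which is the unit for inflation. -/
def wordClass : List Letter → Set Permutation
  | [] => classUnit
  | a :: w => inflate a.toClass (wordClass w)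

/-- `C` is the class represented by some word. -/
def Representable (C : Set Permutation) : Prop :=
  ∃ w : List Letter, C = wordClass w

end PermSplit

/-!
The proof treats unsplittability as a primality property: `X` is unsplittable iff `X ⊆ C ⊙ D`, for
classes `C` and `D`, forces `X ⊆ C` or `X ⊆ D` (`not_splittable_iff`). Here `⊙` is the merge.

Each class of the alphabet is generated from the empty permutation by one of the operations `⊕`,
`⊖` and by adding the permutation `1` on a fixed side with a fixed one of the two operations
(`Letter.toClass_eq_genClass`). Inflating it by `Y` gives the class `genClass b o Y`, where members
of `Y` are added instead of `1` (`inflate_genClass`). So the representable classes are the iterated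
`genClass`es, and a Ramsey argument along the generation shows that `genClass b o Y` is prime when
`Y` is (`mergePrime_genClass`).

Conversely, let `X` be a prime proper subclass of the separable permutations. If `α ∈ X` and
neither `α ⊕ α` nor `α ⊖ α` is in `X`, then at each node of the decomposition tree of a member of
`X` one side avoids `α`. Collecting these sides covers `X` by a merge of boundedly many copies of
`Av α`, which primality forbids; hence `X` is closed under `⊕`, say (`MergePrime.exists_closed`),
and it is not closed under `⊖`. Colouring the sides of the `⊖`-nodes by whether they may be combined
with every member of `X` covers `X` by a merge of classes of the form `genClass ⊕ o Y` with `Y` a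
proper subclass of `X`, so `X` is one of these (`MergePrime.exists_eq_genClass`). A minimal such `Y`
is prime (`MergePrime.exists_prime_generator`), and the theorem follows by induction. Both the
induction and the minimal choices are possible since separable permutations are well-quasi-ordered
by containment (`partiallyWellOrderedOn_Sep`), so that their classes satisfy the descending chain
condition.
-/

namespace PermSplit

/-! ### Embeddings and patterns -/

/-- An embedding of `σ` into `π`: a map between positions that preserves the order of positions and
the order of values. -/
structure Emb (σ π : Permutation) where
  toFun : Fin σ.1 → Fin π.1
  pos : StrictMono toFun
  val : ∀ {i j}, σ.2 i < σ.2 j → π.2 (toFun i) < π.2 (toFun j)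

instance (σ π : Permutation) : CoeFun (Emb σ π) (fun _ => Fin σ.1 → Fin π.1) := ⟨Emb.toFun⟩

variable {σ τ ρ π x y : Permutation} {X Y : Set Permutation} {b : Bool} {o : Bool × Bool}

lemma Emb.val_iff (f : Emb σ π) (i j : Fin σ.1) : σ.2 i < σ.2 j ↔ π.2 (f i) < π.2 (f j) := by
  refine ⟨f.val, fun h => ?_⟩
  by_contra h'
  rcases (not_lt.1 h').lt_or_eq with h'' | h''
  · exact lt_asymm h (f.val h'')
  · rw [σ.2.injective h''] at h
    exact lt_irrefl _ h

def Emb.refl (σ : Permutation) : Emb σ σ := ⟨id, strictMono_id, id⟩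

def Emb.comp (g : Emb σ π) (f : Emb ρ σ) : Emb ρ π :=
  ⟨g ∘ f, g.pos.comp f.pos, fun h => g.val (f.val h)⟩

lemma isPatternOf_iff {S : Set (Fin π.1)} :
    IsPatternOf σ π S ↔ ∃ f : Emb σ π, Set.range f = S := by
  constructor
  · rintro ⟨f, hf, h⟩
    exact ⟨⟨f, f.strictMono, fun {i j} => (h i j).1⟩, hf⟩
  · rintro ⟨f, hf⟩
    exact ⟨OrderEmbedding.ofStrictMono f f.pos, hf, f.val_iff⟩

lemma contained_iff : Contained σ π ↔ Nonempty (Emb σ π) := by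
  constructor
  · rintro ⟨S, h⟩
    obtain ⟨f, -⟩ := isPatternOf_iff.1 h
    exact ⟨f⟩
  · rintro ⟨f⟩
    exact ⟨_, isPatternOf_iff.2 ⟨f, rfl⟩⟩

lemma Emb.contained (f : Emb σ π) : Contained σ π := contained_iff.2 ⟨f⟩

lemma Contained.refl (σ : Permutation) : Contained σ σ := (Emb.refl σ).contained

lemma Contained.trans (h : Contained ρ σ) (h' : Contained σ π) : Contained ρ π := by
  obtain ⟨f⟩ := contained_iff.1 h
  obtain ⟨g⟩ := contained_iff.1 h'
  exact (g.comp f).contained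

lemma Contained.size_le (h : Contained σ π) : σ.1 ≤ π.1 := by
  obtain ⟨f⟩ := contained_iff.1 h
  simpa using Fintype.card_le_of_injective f f.pos.injective

/-- An order isomorphism of `Fin n` is the identity, so a surjective embedding is an equality. -/
lemma eq_of_surjective (f : Emb σ π) (hf : Function.Surjective f) : σ = π := by
  obtain ⟨n, s⟩ := σ
  obtain ⟨m, p⟩ := π
  obtain rfl : n = m := by
    simpa using Fintype.card_congr (Equiv.ofBijective f ⟨f.pos.injective, hf⟩)
  have hid : ∀ i, f i = i := fun i => by
    have : (OrderIso.ofSurjective (OrderEmbedding.ofStrictMono f f.pos) hf : Fin n ≃o Fin n)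
      = OrderIso.refl _ := Subsingleton.elim _ _
    exact congrArg (fun e : Fin n ≃o Fin n => e i) this
  have hmono : StrictMono (s.symm.trans p) := fun i j hij => by
    have h := f.val (i := s.symm i) (j := s.symm j) (by simpa using hij)
    simpa [hid] using h
  have hp : ∀ i, (s.symm.trans p) i = i := fun i => by
    have : (OrderIso.ofSurjective (OrderEmbedding.ofStrictMono _ hmono)
      (s.symm.trans p).surjective : Fin n ≃o Fin n) = OrderIso.refl _ := Subsingleton.elim _ _
    exact congrArg (fun e : Fin n ≃o Fin n => e i) this
  congr 1
  ext i : 1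
  have := hp (s i)
  simpa using this.symm

lemma Contained.antisymm (h : Contained σ π) (h' : Contained π σ) : σ = π := by
  have hn : σ.1 = π.1 := le_antisymm h.size_le h'.size_le
  obtain ⟨f⟩ := contained_iff.1 h
  refine eq_of_surjective f ?_
  exact ((Fintype.bijective_iff_injective_and_card f).2 ⟨f.pos.injective, by simpa using hn⟩).2

/-- Standardization: a sequence of distinct values is order-isomorphic to a permutation. -/
lemma exists_perm_of_injective {n : ℕ} {α : Type*} [LinearOrder α] (u : Fin n → α)
    (hu : Function.Injective u) : ∃ s : Equiv.Perm (Fin n), ∀ i j, s i < s j → u i < u j := by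
  classical
  have hc : (Finset.univ.image u).card = n := by
    rw [Finset.card_image_of_injective _ hu, Finset.card_univ, Fintype.card_fin]
  let e := (Finset.univ.image u).orderIsoOfFin hc
  let s : Fin n → Fin n := fun i => e.symm ⟨u i, by simp⟩
  have hs : Function.Injective s := fun i j h => hu (by simpa [s] using h)
  refine ⟨Equiv.ofBijective s (Finite.injective_iff_bijective.1 hs), fun i j h => ?_⟩
  simpa [s] using h

/-- Every set of positions has a pattern. -/
lemma exists_isPatternOf (π : Permutation) (S : Set (Fin π.1)) : ∃ σ, IsPatternOf σ π S := by
  classical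
  let e := S.toFinset.orderEmbOfFin rfl
  obtain ⟨s, hs⟩ := exists_perm_of_injective (fun i => π.2 (e i))
    (π.2.injective.comp e.injective)
  refine ⟨⟨_, s⟩, isPatternOf_iff.2 ⟨⟨e, e.strictMono, fun {i j} => hs i j⟩, ?_⟩⟩
  simp [e]

/-- An embedding whose image lies in the image of `f` factors through `f`. -/
lemma Emb.factor (f : Emb σ π) (h : Emb ρ π) (hr : ∀ i, h i ∈ Set.range f) :
    ∃ g : Emb ρ σ, ∀ i, f (g i) = h i := by
  choose g hg using hr
  refine ⟨⟨g, fun i j hij => ?_, fun {i j} hij => ?_⟩, hg⟩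
  · rw [← f.pos.lt_iff_lt, hg, hg]
    exact h.pos hij
  · rw [f.val_iff, hg, hg]
    exact h.val hij

lemma IsPatternOf.contained_of_emb {S : Set (Fin π.1)} (h : IsPatternOf σ π S) (g : Emb ρ π)
    (hg : ∀ i, g i ∈ S) : Contained ρ σ := by
  obtain ⟨f, rfl⟩ := isPatternOf_iff.1 h
  exact (f.factor g hg).choose.contained

lemma IsPatternOf.preimage {S : Set (Fin π.1)} (h : IsPatternOf σ π S) (g : Emb ρ π)
    (hg : S ⊆ Set.range g) : IsPatternOf σ ρ (g ⁻¹' S) := by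
  obtain ⟨f, rfl⟩ := isPatternOf_iff.1 h
  obtain ⟨k, hk⟩ := g.factor f (fun i => hg ⟨i, rfl⟩)
  refine isPatternOf_iff.2 ⟨k, ?_⟩
  ext x
  simp only [Set.mem_range, Set.mem_preimage]
  constructor
  · rintro ⟨i, rfl⟩
    exact ⟨i, (hk i).symm⟩
  · rintro ⟨i, hi⟩
    exact ⟨i, g.pos.injective (by rw [hk, hi])⟩

lemma IsPatternOf.image {S : Set (Fin ρ.1)} (h : IsPatternOf σ ρ S) (g : Emb ρ π) :
    IsPatternOf σ π (g '' S) := by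
  obtain ⟨f, rfl⟩ := isPatternOf_iff.1 h
  exact isPatternOf_iff.2 ⟨g.comp f, Set.range_comp g f⟩

lemma emptyPerm_contained (π : Permutation) : Contained emptyPerm π :=
  Emb.contained ⟨fun i : Fin 0 => i.elim0, fun i : Fin 0 => i.elim0,
    fun {i : Fin 0} => i.elim0⟩

lemma eq_emptyPerm (h : π.1 = 0) : π = emptyPerm := by
  refine ((emptyPerm_contained π).antisymm ?_).symm
  have : IsEmpty (Fin π.1) := by rw [h]; infer_instance
  exact Emb.contained ⟨isEmptyElim, fun i => isEmptyElim i, fun {i} => isEmptyElim i⟩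

lemma onePerm_contained (h : 0 < π.1) : Contained onePerm π :=
  Emb.contained ⟨fun _ : Fin 1 => ⟨0, h⟩, fun i j hij => by
    exact absurd hij (by rw [Subsingleton.elim (α := Fin 1) i j]; exact lt_irrefl _),
    fun {i j} hij => absurd hij (by
      rw [Subsingleton.elim (α := Fin 1) i j]; exact lt_irrefl _)⟩

lemma eq_onePerm (h : π.1 = 1) : π = onePerm := by
  refine eq_of_surjective (Classical.choice (contained_iff.1
    (onePerm_contained (π := π) (by omega)))) ?_ |>.symm
  intro x
  have : Subsingleton (Fin π.1) := by rw [h]; infer_instance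
  exact ⟨(0 : Fin 1), Subsingleton.elim _ _⟩

/-! ### Sums and skew sums -/

/-- The sum (`b = true`) or the skew sum (`b = false`) of two permutations. -/
def comb (b : Bool) (σ τ : Permutation) : Permutation :=
  ⟨σ.1 + τ.1, bif b then (dirSum σ τ).2 else (skewSum σ τ).2⟩

/-- The strict order in which the values of the left part of `comb b` precede those of the right
part: `<` for `b = true` and `>` for `b = false`. -/
def vlt (b : Bool) {n : ℕ} (x y : Fin n) : Prop := bif b then x < y else y < x

lemma comb_castAdd (b : Bool) (σ τ : Permutation) (i : Fin σ.1) :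
    ((comb b σ τ).2 (Fin.castAdd τ.1 i)).1 = bif b then (σ.2 i).1 else τ.1 + (σ.2 i).1 := by
  cases b
  · change (finCongr (Nat.add_comm τ.1 σ.1) (finSumFinEquiv ((Equiv.sumComm _ _)
      (Equiv.sumCongr σ.2 τ.2 (finSumFinEquiv.symm (Fin.castAdd τ.1 i)))))).1 = _
    rw [finSumFinEquiv_symm_apply_castAdd]
    simp [Nat.add_comm]
  · change (finSumFinEquiv (Equiv.sumCongr σ.2 τ.2
      (finSumFinEquiv.symm (Fin.castAdd τ.1 i)))).1 = _
    rw [finSumFinEquiv_symm_apply_castAdd]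
    simp

lemma comb_natAdd (b : Bool) (σ τ : Permutation) (i : Fin τ.1) :
    ((comb b σ τ).2 (Fin.natAdd σ.1 i)).1 = bif b then σ.1 + (τ.2 i).1 else (τ.2 i).1 := by
  cases b
  · change (finCongr (Nat.add_comm τ.1 σ.1) (finSumFinEquiv ((Equiv.sumComm _ _)
      (Equiv.sumCongr σ.2 τ.2 (finSumFinEquiv.symm (Fin.natAdd σ.1 i)))))).1 = _
    rw [finSumFinEquiv_symm_apply_natAdd]
    simp
  · change (finSumFinEquiv (Equiv.sumCongr σ.2 τ.2
      (finSumFinEquiv.symm (Fin.natAdd σ.1 i)))).1 = _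
    rw [finSumFinEquiv_symm_apply_natAdd]
    simp

lemma comb_castAdd_lt (b : Bool) (σ τ : Permutation) (i j : Fin σ.1) (h : σ.2 i < σ.2 j) :
    (comb b σ τ).2 (Fin.castAdd τ.1 i) < (comb b σ τ).2 (Fin.castAdd τ.1 j) := by
  rw [Fin.lt_def, comb_castAdd, comb_castAdd]
  cases b
  · exact Nat.add_lt_add_left h _
  · exact h

lemma comb_natAdd_lt (b : Bool) (σ τ : Permutation) (i j : Fin τ.1) (h : τ.2 i < τ.2 j) :
    (comb b σ τ).2 (Fin.natAdd σ.1 i) < (comb b σ τ).2 (Fin.natAdd σ.1 j) := by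
  rw [Fin.lt_def, comb_natAdd, comb_natAdd]
  cases b
  · exact h
  · exact Nat.add_lt_add_left h _

/-- The embedding of the left summand. -/
def inl (b : Bool) (σ τ : Permutation) : Emb σ (comb b σ τ) :=
  ⟨Fin.castAdd τ.1, Fin.strictMono_castAdd _, fun {i j} => comb_castAdd_lt b σ τ i j⟩

/-- The embedding of the right summand. -/
def inr (b : Bool) (σ τ : Permutation) : Emb τ (comb b σ τ) :=
  ⟨Fin.natAdd σ.1, Fin.strictMono_natAdd _, fun {i j} => comb_natAdd_lt b σ τ i j⟩

lemma inl_lt_inr (i : Fin x.1) (j : Fin y.1) : inl b x y i < inr b x y j :=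
  Fin.lt_def.2 (Nat.lt_add_right _ i.2 : i.1 < x.1 + j.1)

lemma inl_ne_inr (i : Fin x.1) (j : Fin y.1) : inl b x y i ≠ inr b x y j := (inl_lt_inr i j).ne

lemma vlt_inl_inr (i : Fin x.1) (j : Fin y.1) :
    vlt b ((comb b x y).2 (inl b x y i)) ((comb b x y).2 (inr b x y j)) := by
  have h1 := comb_castAdd b x y i
  have h2 := comb_natAdd b x y j
  have h3 := (x.2 i).2
  have h4 := (y.2 j).2
  cases b
  · exact Fin.lt_def.2 (h1 ▸ h2 ▸ Nat.lt_add_right _ h4)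
  · exact Fin.lt_def.2 (h1 ▸ h2 ▸ Nat.lt_add_right _ h3)

lemma comb_cases {P : Fin (comb b x y).1 → Prop} (hl : ∀ i, P (inl b x y i))
    (hr : ∀ j, P (inr b x y j)) (k : Fin (comb b x y).1) : P k :=
  Fin.addCases (m := x.1) (n := y.1) hl hr k

/-- Two embeddings whose images are placed relative to each other as the parts of `comb b x y`
extend to an embedding of `comb b x y`. -/
lemma comb_desc (f : Emb x π) (g : Emb y π) (hp : ∀ i j, f i < g j)
    (hv : ∀ i j, vlt b (π.2 (f i)) (π.2 (g j))) :
    ∃ h : Emb (comb b x y) π, (∀ i, h (inl b x y i) = f i) ∧ ∀ j, h (inr b x y j) = g j := by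
  let h : Fin (comb b x y).1 → Fin π.1 := Fin.addCases (m := x.1) (n := y.1) f g
  have h1 : ∀ i, h (inl b x y i) = f i := fun i => Fin.addCases_left (m := x.1) (n := y.1) i
  have h2 : ∀ i, h (inr b x y i) = g i := fun i => Fin.addCases_right (m := x.1) (n := y.1) i
  refine ⟨⟨h, fun i => ?_, fun {i} => ?_⟩, h1, h2⟩
  · induction i using comb_cases with
    | hl i =>
      intro j
      induction j using comb_cases with
      | hl j => intro hij; rw [h1, h1]; exact f.pos ((inl b x y).pos.lt_iff_lt.1 hij)
      | hr j => intro _; rw [h1, h2]; exact hp i j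
    | hr i =>
      intro j
      induction j using comb_cases with
      | hl j => intro hij; exact absurd hij (inl_lt_inr j i).not_gt
      | hr j => intro hij; rw [h2, h2]; exact g.pos ((inr b x y).pos.lt_iff_lt.1 hij)
  · induction i using comb_cases with
    | hl i =>
      intro j
      induction j using comb_cases with
      | hl j => intro hij; rw [h1, h1]; exact f.val (((inl b x y).val_iff i j).2 hij)
      | hr j =>
        intro hij
        rw [h1, h2]
        have := hv i j
        have h' := vlt_inl_inr (b := b) i j
        cases b
        · exact absurd hij (lt_asymm h')
        · exact this
    | hr i =>
      intro j
      induction j using comb_cases with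
      | hl j =>
        intro hij
        rw [h1, h2]
        have := hv j i
        have h' := vlt_inl_inr (b := b) j i
        cases b
        · exact this
        · exact absurd hij (lt_asymm h')
      | hr j => intro hij; rw [h2, h2]; exact g.val (((inr b x y).val_iff i j).2 hij)

lemma contained_comb_left (b : Bool) (x y : Permutation) : Contained x (comb b x y) :=
  (inl b x y).contained

lemma contained_comb_right (b : Bool) (x y : Permutation) : Contained y (comb b x y) :=
  (inr b x y).contained

lemma Emb.vlt_iff (f : Emb σ π) (i j : Fin σ.1) :
    vlt b (σ.2 i) (σ.2 j) ↔ vlt b (π.2 (f i)) (π.2 (f j)) := by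
  cases b
  · exact f.val_iff j i
  · exact f.val_iff i j

/-- A permutation is a (skew) sum of the patterns of an initial segment of positions and of its
complement whenever the values compare accordingly. -/
lemma exists_eq_comb (b : Bool) (π : Permutation) (S : Set (Fin π.1))
    (hp : ∀ i ∈ S, ∀ j ∉ S, i < j) (hv : ∀ i ∈ S, ∀ j ∉ S, vlt b (π.2 i) (π.2 j)) :
    ∃ x y, π = comb b x y ∧
      ∃ (f : Emb x π) (g : Emb y π), Set.range f = S ∧ Set.range g = Sᶜ := by
  obtain ⟨x, hx⟩ := exists_isPatternOf π S
  obtain ⟨y, hy⟩ := exists_isPatternOf π Sᶜ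
  obtain ⟨f, hf⟩ := isPatternOf_iff.1 hx
  obtain ⟨g, hg⟩ := isPatternOf_iff.1 hy
  have hf' : ∀ i, f i ∈ S := fun i => hf ▸ ⟨i, rfl⟩
  have hg' : ∀ j, g j ∉ S := fun j => by
    have : g j ∈ Sᶜ := hg ▸ ⟨j, rfl⟩
    exact this
  obtain ⟨h, h1, h2⟩ := comb_desc (b := b) f g (fun i j => hp _ (hf' i) _ (hg' j))
    (fun i j => hv _ (hf' i) _ (hg' j))
  refine ⟨x, y, (eq_of_surjective h fun k => ?_).symm, f, g, hf, hg⟩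
  by_cases hk : k ∈ S
  · rw [← hf] at hk
    obtain ⟨i, rfl⟩ := hk
    exact ⟨_, h1 i⟩
  · have hk : k ∈ Sᶜ := hk
    rw [← hg] at hk
    obtain ⟨i, rfl⟩ := hk
    exact ⟨_, h2 i⟩

lemma Emb.comb_map (f : Emb σ x) (g : Emb τ y) (b : Bool) :
    ∃ h : Emb (comb b σ τ) (comb b x y), (∀ i, h (inl b σ τ i) = inl b x y (f i)) ∧
      ∀ j, h (inr b σ τ j) = inr b x y (g j) :=
  comb_desc ((inl b x y).comp f) ((inr b x y).comp g) (fun _ _ => inl_lt_inr _ _)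
    (fun _ _ => vlt_inl_inr _ _)

lemma Contained.comb (h : Contained σ x) (h' : Contained τ y) (b : Bool) :
    Contained (comb b σ τ) (comb b x y) := by
  obtain ⟨f⟩ := contained_iff.1 h
  obtain ⟨g⟩ := contained_iff.1 h'
  obtain ⟨k, -⟩ := f.comb_map g b
  exact k.contained

/-- A permutation contained in a (skew) sum is the (skew) sum of its parts in the two summands,
either of which may be empty. -/
lemma Contained.exists_comb (h : Contained π (PermSplit.comb b x y)) :
    ∃ x' y', π = PermSplit.comb b x' y' ∧ Contained x' x ∧ Contained y' y := by
  obtain ⟨e⟩ := contained_iff.1 h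
  have key : ∀ k, e k ∈ Set.range (inl b x y) ∨ e k ∈ Set.range (inr b x y) := fun k => by
    generalize e k = l
    induction l using comb_cases with
    | hl i => exact Or.inl ⟨i, rfl⟩
    | hr i => exact Or.inr ⟨i, rfl⟩
  have key' : ∀ k, e k ∉ Set.range (inl b x y) → e k ∈ Set.range (inr b x y) :=
    fun k hk => (key k).resolve_left hk
  obtain ⟨x', y', rfl, f, g, hf, hg⟩ := exists_eq_comb b π (e ⁻¹' Set.range (inl b x y))
    (by
      rintro i ⟨i', hi⟩ j hj
      obtain ⟨j', hj⟩ := key' j hj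
      rw [← e.pos.lt_iff_lt, ← hi, ← hj]
      exact inl_lt_inr _ _)
    (by
      rintro i ⟨i', hi⟩ j hj
      obtain ⟨j', hj⟩ := key' j hj
      rw [e.vlt_iff, ← hi, ← hj]
      exact vlt_inl_inr _ _)
  refine ⟨x', y', rfl, ?_, ?_⟩
  · refine ((inl b x y).factor (e.comp f) fun i => ?_).choose.contained
    have : f i ∈ Set.range f := ⟨i, rfl⟩
    rw [hf] at this
    exact this
  · refine ((inr b x y).factor (e.comp g) fun i => ?_).choose.contained
    have : g i ∈ Set.range g := ⟨i, rfl⟩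
    rw [hg] at this
    exact key' _ this

lemma comb_emptyPerm (b : Bool) (x : Permutation) : comb b x emptyPerm = x := by
  refine (eq_of_surjective (inl b x emptyPerm) fun k => ?_).symm
  induction k using comb_cases with
  | hl i => exact ⟨i, rfl⟩
  | hr j => exact Fin.elim0 (show Fin 0 from j)

lemma emptyPerm_comb (b : Bool) (x : Permutation) : comb b emptyPerm x = x := by
  refine (eq_of_surjective (inr b emptyPerm x) fun k => ?_).symm
  induction k using comb_cases with
  | hl i => exact Fin.elim0 (show Fin 0 from i)
  | hr j => exact ⟨j, rfl⟩

lemma comb_assoc (b : Bool) (x y z : Permutation) :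
    comb b (comb b x y) z = comb b x (comb b y z) := by
  obtain ⟨h, h1, h2⟩ := comb_desc (b := b) (inl b x (comb b y z))
    ((inr b x (comb b y z)).comp (inl b y z)) (fun _ _ => inl_lt_inr _ _)
    (fun _ _ => vlt_inl_inr _ _)
  obtain ⟨k, k1, k2⟩ := comb_desc (b := b) h ((inr b x (comb b y z)).comp (inr b y z))
    (fun i j => by
      induction i using comb_cases with
      | hl i => rw [h1]; exact inl_lt_inr _ _
      | hr i => rw [h2]; exact (inr b x (comb b y z)).pos (inl_lt_inr _ _))
    (fun i j => by
      induction i using comb_cases with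
      | hl i => rw [h1]; exact vlt_inl_inr _ _
      | hr i => rw [h2]; exact ((inr b x (comb b y z)).vlt_iff _ _).1 (vlt_inl_inr _ _))
  refine eq_of_surjective k fun l => ?_
  induction l using comb_cases with
  | hl i => exact ⟨inl b _ z (inl b x y i), by rw [k1, h1]⟩
  | hr l =>
    induction l using comb_cases with
    | hl i => exact ⟨inl b _ z (inr b x y i), by rw [k1, h2]; rfl⟩
    | hr i => exact ⟨inr b _ z i, by rw [k2]; rfl⟩

/-- The four binary operations `x ⊕ y`, `y ⊕ x`, `x ⊖ y`, `y ⊖ x`: the first component of `o`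
chooses between sum (`true`) and skew sum (`false`), the second one tells whether the first argument is put on the left. -/
def op (o : Bool × Bool) (x y : Permutation) : Permutation :=
  bif o.2 then comb o.1 x y else comb o.1 y x

lemma op_emptyPerm (o : Bool × Bool) (x : Permutation) : op o x emptyPerm = x := by
  obtain ⟨c, _ | _⟩ := o
  · exact emptyPerm_comb c x
  · exact comb_emptyPerm c x

lemma emptyPerm_op (o : Bool × Bool) (x : Permutation) : op o emptyPerm x = x := by
  obtain ⟨c, _ | _⟩ := o
  · exact comb_emptyPerm c x
  · exact emptyPerm_comb c x

lemma contained_op_right (o : Bool × Bool) (x y : Permutation) : Contained y (op o x y) := by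
  obtain ⟨c, _ | _⟩ := o
  · exact contained_comb_left c y x
  · exact contained_comb_right c x y

lemma Contained.op (h : Contained σ x) (h' : Contained τ y) (o : Bool × Bool) :
    Contained (op o σ τ) (op o x y) := by
  obtain ⟨c, _ | _⟩ := o
  · exact h'.comb h c
  · exact h.comb h' c

lemma Contained.exists_op {o : Bool × Bool} (h : Contained π (PermSplit.op o x y)) :
    ∃ x' y', π = PermSplit.op o x' y' ∧ Contained x' x ∧ Contained y' y := by
  obtain ⟨c, _ | _⟩ := o
  · obtain ⟨y', x', h, hy, hx⟩ := Contained.exists_comb h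
    exact ⟨x', y', h, hx, hy⟩
  · exact Contained.exists_comb h

/-! ### Merges -/

/-- `π` is a merge of `s` and `t`. -/
def IsMerge (π s t : Permutation) : Prop :=
  ∃ S : Set (Fin π.1), IsPatternOf s π S ∧ IsPatternOf t π Sᶜ

lemma mem_merge {C D : Set Permutation} :
    π ∈ merge C D ↔ ∃ s ∈ C, ∃ t ∈ D, IsMerge π s t := by
  constructor
  · rintro ⟨S, s, hs, t, ht, h⟩
    exact ⟨s, hs, t, ht, S, h⟩
  · rintro ⟨s, hs, t, ht, S, h⟩
    exact ⟨S, s, hs, t, ht, h⟩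

lemma isPatternOf_univ (π : Permutation) : IsPatternOf π π Set.univ :=
  isPatternOf_iff.2 ⟨Emb.refl π, Set.range_id⟩

lemma isPatternOf_empty (π : Permutation) : IsPatternOf emptyPerm π ∅ := by
  obtain ⟨f⟩ := contained_iff.1 (emptyPerm_contained π)
  have : IsEmpty (Fin emptyPerm.1) := inferInstanceAs (IsEmpty (Fin 0))
  exact isPatternOf_iff.2 ⟨f, Set.range_eq_empty _⟩

lemma isMerge_emptyPerm (π : Permutation) : IsMerge π π emptyPerm :=
  ⟨Set.univ, isPatternOf_univ π, by rw [Set.compl_univ]; exact isPatternOf_empty π⟩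

lemma emptyPerm_isMerge (π : Permutation) : IsMerge π emptyPerm π :=
  ⟨∅, isPatternOf_empty π, by rw [Set.compl_empty]; exact isPatternOf_univ π⟩

lemma IsMerge.comb {s t s' t' : Permutation} (h : IsMerge x s t) (h' : IsMerge y s' t') (b : Bool) :
    IsMerge (comb b x y) (comb b s s') (comb b t t') := by
  obtain ⟨S, hs, ht⟩ := h
  obtain ⟨S', hs', ht'⟩ := h'
  obtain ⟨f, rfl⟩ := isPatternOf_iff.1 hs
  obtain ⟨g, hg⟩ := isPatternOf_iff.1 ht
  obtain ⟨f', rfl⟩ := isPatternOf_iff.1 hs'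
  obtain ⟨g', hg'⟩ := isPatternOf_iff.1 ht'
  obtain ⟨k, k1, k2⟩ := f.comb_map f' b
  obtain ⟨l, l1, l2⟩ := g.comb_map g' b
  refine ⟨Set.range k, isPatternOf_iff.2 ⟨k, rfl⟩, isPatternOf_iff.2 ⟨l, ?_⟩⟩
  have key : ∀ i, i ∈ Set.range f ∨ i ∈ Set.range g := fun i => by
    rw [hg]; exact em _
  have key' : ∀ i, i ∈ Set.range f' ∨ i ∈ Set.range g' := fun i => by
    rw [hg']; exact em _
  have disj : ∀ i j, g j ≠ f i := fun i j hij => by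
    have : g j ∈ (Set.range f)ᶜ := hg ▸ ⟨j, rfl⟩
    exact this ⟨i, hij.symm⟩
  have disj' : ∀ i j, g' j ≠ f' i := fun i j hij => by
    have : g' j ∈ (Set.range f')ᶜ := hg' ▸ ⟨j, rfl⟩
    exact this ⟨i, hij.symm⟩
  apply Set.Subset.antisymm
  · rintro _ ⟨j, rfl⟩ ⟨i, hi⟩
    induction j using comb_cases with
    | hl j =>
      induction i using comb_cases with
      | hl i => rw [k1, l1] at hi; exact disj i j ((inl b x y).pos.injective hi).symm
      | hr i => rw [k2, l1] at hi; exact inl_ne_inr _ _ hi.symm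
    | hr j =>
      induction i using comb_cases with
      | hl i => rw [k1, l2] at hi; exact inl_ne_inr _ _ hi
      | hr i => rw [k2, l2] at hi; exact disj' i j ((inr b x y).pos.injective hi).symm
  · intro m hm
    induction m using comb_cases with
    | hl m =>
      rcases key m with ⟨i, rfl⟩ | ⟨i, rfl⟩
      · exact absurd ⟨_, k1 i⟩ hm
      · exact ⟨_, l1 i⟩
    | hr m =>
      rcases key' m with ⟨i, rfl⟩ | ⟨i, rfl⟩
      · exact absurd ⟨_, k2 i⟩ hm
      · exact ⟨_, l2 i⟩

lemma IsMerge.op {s t s' t' : Permutation} (h : IsMerge x s t) (h' : IsMerge y s' t')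
    (o : Bool × Bool) : IsMerge (op o x y) (op o s s') (op o t t') := by
  obtain ⟨c, _ | _⟩ := o
  · exact h'.comb h c
  · exact h.comb h' c

lemma isMerge_op (o : Bool × Bool) (x y : Permutation) : IsMerge (op o x y) x y := by
  have := (isMerge_emptyPerm x).op (emptyPerm_isMerge y) o
  rwa [op_emptyPerm, emptyPerm_op] at this

/-- A partition of the elements of a (skew) sum restricts to both summands. -/
lemma IsMerge.exists_of_comb {s t : Permutation} (h : IsMerge (PermSplit.comb b x y) s t) :
    ∃ s₁ t₁ s₂ t₂, IsMerge x s₁ t₁ ∧ IsMerge y s₂ t₂ ∧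
      Contained (PermSplit.comb b s₁ s₂) s ∧ Contained (PermSplit.comb b t₁ t₂) t := by
  obtain ⟨S, hs, ht⟩ := h
  have key : ∀ (u : Permutation) (T : Set (Fin (PermSplit.comb b x y).1)),
      IsPatternOf u (PermSplit.comb b x y) T → ∀ u₁ u₂, IsPatternOf u₁ x (inl b x y ⁻¹' T) →
      IsPatternOf u₂ y (inr b x y ⁻¹' T) → Contained (PermSplit.comb b u₁ u₂) u := by
    intro u T hu u₁ u₂ h₁ h₂
    obtain ⟨f, hf⟩ := isPatternOf_iff.1 h₁
    obtain ⟨g, hg⟩ := isPatternOf_iff.1 h₂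
    obtain ⟨k, k1, k2⟩ := f.comb_map g b
    refine hu.contained_of_emb k fun i => ?_
    induction i using comb_cases with
    | hl i =>
      have : f i ∈ Set.range f := ⟨i, rfl⟩
      rw [k1]
      rwa [hf] at this
    | hr i =>
      have : g i ∈ Set.range g := ⟨i, rfl⟩
      rw [k2]
      rwa [hg] at this
  obtain ⟨s₁, hs₁⟩ := exists_isPatternOf x (inl b x y ⁻¹' S)
  obtain ⟨t₁, ht₁⟩ := exists_isPatternOf x (inl b x y ⁻¹' Sᶜ)
  obtain ⟨s₂, hs₂⟩ := exists_isPatternOf y (inr b x y ⁻¹' S)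
  obtain ⟨t₂, ht₂⟩ := exists_isPatternOf y (inr b x y ⁻¹' Sᶜ)
  exact ⟨s₁, t₁, s₂, t₂, ⟨_, hs₁, ht₁⟩, ⟨_, hs₂, ht₂⟩, key s S hs _ _ hs₁ hs₂,
    key t Sᶜ ht _ _ ht₁ ht₂⟩

lemma IsMerge.exists_of_op {s t : Permutation} {o : Bool × Bool}
    (h : IsMerge (PermSplit.op o x y) s t) :
    ∃ s₁ t₁ s₂ t₂, IsMerge x s₁ t₁ ∧ IsMerge y s₂ t₂ ∧
      Contained (PermSplit.op o s₁ s₂) s ∧ Contained (PermSplit.op o t₁ t₂) t := by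
  obtain ⟨c, _ | _⟩ := o
  · obtain ⟨s₁, t₁, s₂, t₂, h₁, h₂, hs, ht⟩ := IsMerge.exists_of_comb h
    exact ⟨s₂, t₂, s₁, t₁, h₂, h₁, hs, ht⟩
  · exact IsMerge.exists_of_comb h

/-- A partition of the elements of `π` restricts to each permutation contained in `π`. -/
lemma IsMerge.exists_of_contained {s t : Permutation} (h : IsMerge π s t) (hσ : Contained σ π) :
    ∃ s' t', IsMerge σ s' t' ∧ Contained s' s ∧ Contained t' t := by
  obtain ⟨S, hs, ht⟩ := h
  obtain ⟨f⟩ := contained_iff.1 hσ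
  obtain ⟨s', hs'⟩ := exists_isPatternOf σ (f ⁻¹' S)
  obtain ⟨t', ht'⟩ := exists_isPatternOf σ (f ⁻¹' Sᶜ)
  refine ⟨s', t', ⟨_, hs', ht'⟩, ?_, ?_⟩
  · obtain ⟨g, hg⟩ := isPatternOf_iff.1 hs'
    exact hs.contained_of_emb (f.comp g) fun i => by
      have : g i ∈ Set.range g := ⟨i, rfl⟩
      rwa [hg] at this
  · obtain ⟨g, hg⟩ := isPatternOf_iff.1 ht'
    exact ht.contained_of_emb (f.comp g) fun i => by
      have : g i ∈ Set.range g := ⟨i, rfl⟩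
      rwa [hg] at this

section Merge

variable {C D : Set Permutation}

lemma IsMerge.contained_left {s t : Permutation} (h : IsMerge π s t) : Contained s π :=
  ⟨_, h.choose_spec.1⟩

lemma IsMerge.contained_right {s t : Permutation} (h : IsMerge π s t) : Contained t π :=
  ⟨_, h.choose_spec.2⟩

lemma isPermClass_merge (hC : IsPermClass C) (hD : IsPermClass D) : IsPermClass (merge C D) := by
  intro π hπ σ hσ
  obtain ⟨s, hs, t, ht, h⟩ := mem_merge.1 hπ
  obtain ⟨s', t', h', hs', ht'⟩ := h.exists_of_contained hσ
  exact mem_merge.2 ⟨s', hC s hs s' hs', t', hD t ht t' ht', h'⟩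

lemma isPermClass_Av (α : Permutation) : IsPermClass (Av α) :=
  fun _ hπ _ hσ h => hπ (h.trans hσ)

lemma IsPermClass.inter (hC : IsPermClass C) (hD : IsPermClass D) : IsPermClass (C ∩ D) :=
  fun π hπ σ hσ => ⟨hC π hπ.1 σ hσ, hD π hπ.2 σ hσ⟩

lemma mem_merge_left (hD : emptyPerm ∈ D) (h : π ∈ C) : π ∈ merge C D :=
  mem_merge.2 ⟨π, h, _, hD, isMerge_emptyPerm π⟩

lemma mem_merge_right (hC : emptyPerm ∈ C) (h : π ∈ D) : π ∈ merge C D :=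
  mem_merge.2 ⟨_, hC, π, h, emptyPerm_isMerge π⟩

lemma op_mem_merge (o : Bool × Bool) (hx : x ∈ C) (hy : y ∈ D) : op o x y ∈ merge C D :=
  mem_merge.2 ⟨x, hx, y, hy, isMerge_op o x y⟩

lemma comb_mem_merge (hC : ∀ x ∈ C, ∀ y ∈ C, comb b x y ∈ C)
    (hD : ∀ x ∈ D, ∀ y ∈ D, comb b x y ∈ D) :
    ∀ x ∈ merge C D, ∀ y ∈ merge C D, comb b x y ∈ merge C D := by
  intro x hx y hy
  obtain ⟨s, hs, t, ht, h⟩ := mem_merge.1 hx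
  obtain ⟨s', hs', t', ht', h'⟩ := mem_merge.1 hy
  exact mem_merge.2 ⟨_, hC s hs s' hs', _, hD t ht t' ht', h.comb h' b⟩

lemma op_mem_merge_left {o : Bool × Bool} (hC : ∀ z ∈ C, op o x z ∈ C) :
    ∀ z ∈ merge C D, op o x z ∈ merge C D := by
  intro z hz
  obtain ⟨s, hs, t, ht, h⟩ := mem_merge.1 hz
  have := (isMerge_emptyPerm x).op h o
  rw [emptyPerm_op] at this
  exact mem_merge.2 ⟨_, hC s hs, t, ht, this⟩

lemma op_mem_merge_right {o : Bool × Bool} (hD : ∀ z ∈ D, op o x z ∈ D) :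
    ∀ z ∈ merge C D, op o x z ∈ merge C D := by
  intro z hz
  obtain ⟨s, hs, t, ht, h⟩ := mem_merge.1 hz
  have := (emptyPerm_isMerge x).op h o
  rw [emptyPerm_op] at this
  exact mem_merge.2 ⟨s, hs, _, hD t ht, this⟩

end Merge

/-! ### Unsplittable classes as primes for merging -/

/-- `X` is prime for merging: it lies in a merge of two classes only if it lies in one of them. -/
def MergePrime (X : Set Permutation) : Prop :=
  ∀ C D, IsPermClass C → IsPermClass D → X ⊆ merge C D → X ⊆ C ∨ X ⊆ D

lemma isPermClass_mergeList (L : List (Set Permutation)) (hL : ∀ D ∈ L, IsPermClass D) :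
    IsPermClass (mergeList L) := by
  induction L with
  | nil =>
    rintro π rfl σ hσ
    exact eq_emptyPerm (Nat.le_zero.1 hσ.size_le)
  | cons C L ih =>
    exact isPermClass_merge (hL C (by simp)) (ih fun D hD => hL D (by simp [hD]))

/-- Merges with any number of factors reduce to merges of two classes, since a merge of classes is
itself a class. -/
lemma not_splittable_iff (hX : IsPermClass X) (hone : onePerm ∈ X) :
    ¬ Splittable X ↔ MergePrime X := by
  constructor
  · intro h C D hC hD hXCD
    by_contra! hne
    have hprop : ∀ E, ¬ X ⊆ E → E ∩ X ⊂ X := fun E hE =>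
      ⟨Set.inter_subset_right, fun h' => hE fun z hz => (h' hz).1⟩
    refine h ⟨[C ∩ X, D ∩ X], by simp, ?_, fun π hπ => ?_⟩
    · intro E hE
      simp only [List.mem_cons, List.not_mem_nil, or_false] at hE
      rcases hE with rfl | rfl
      · exact ⟨hC.inter hX, hprop _ hne.1⟩
      · exact ⟨hD.inter hX, hprop _ hne.2⟩
    · obtain ⟨s, hs, t, ht, hm⟩ := mem_merge.1 (hXCD hπ)
      exact mem_merge.2 ⟨s, ⟨hs, hX π hπ s hm.contained_left⟩, t,
        mem_merge_left rfl ⟨ht, hX π hπ t hm.contained_right⟩, hm⟩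
  · rintro h ⟨L, -, hL, hXL⟩
    induction L with
    | nil => exact absurd (congrArg Sigma.fst (hXL hone)) Nat.one_ne_zero
    | cons C L ih =>
      have hL' : ∀ D ∈ L, IsPermClass D ∧ D ⊂ X := fun D hD => hL D (by simp [hD])
      rcases h C _ (hL C (by simp)).1 (isPermClass_mergeList L fun D hD => (hL' D hD).1) hXL with
        h' | h'
      · exact (hL C (by simp)).2.2 h'
      · exact ih hL' h'

/-- Primality as a Ramsey property: some `ρ ∈ X` contains `σ` in the first colour or `τ` in the
second one, for every colouring of its elements with two colours. -/
lemma MergePrime.exists_ramsey (h : MergePrime X) (hσ : σ ∈ X) (hτ : τ ∈ X) :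
    ∃ ρ ∈ X, ∀ s t, IsMerge ρ s t → Contained σ s ∨ Contained τ t := by
  by_contra! hne
  rcases h _ _ (isPermClass_Av σ) (isPermClass_Av τ) (fun ρ hρ => by
    obtain ⟨s, t, hm, hs, ht⟩ := hne ρ hρ
    exact mem_merge.2 ⟨s, hs, t, ht, hm⟩) with h' | h'
  · exact h' hσ (Contained.refl σ)
  · exact h' hτ (Contained.refl τ)

lemma mergePrime_of_exists_ramsey
    (h : ∀ σ ∈ X, ∀ τ ∈ X, ∃ ρ ∈ X, ∀ s t, IsMerge ρ s t → Contained σ s ∨ Contained τ t) :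
    MergePrime X := by
  intro C D hC hD hX
  by_contra! hne
  obtain ⟨σ, hσ, hσC⟩ := Set.not_subset.1 hne.1
  obtain ⟨τ, hτ, hτD⟩ := Set.not_subset.1 hne.2
  obtain ⟨ρ, hρ, hR⟩ := h σ hσ τ hτ
  obtain ⟨s, hs, t, ht, hm⟩ := mem_merge.1 (hX hρ)
  rcases hR s t hm with h' | h'
  · exact hσC (hC s hs σ h')
  · exact hτD (hD t ht τ h')

/-- A prime class is directed: in the Ramsey property, use the two constant colourings. -/
lemma MergePrime.exists_upper (h : MergePrime X) (hσ : σ ∈ X) (hτ : τ ∈ X) :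
    ∃ ρ ∈ X, Contained σ ρ ∧ Contained τ ρ := by
  obtain ⟨ρ, hρ, hR⟩ := h.exists_ramsey hσ hτ
  rcases hR _ _ (isMerge_emptyPerm ρ) with h₁ | h₁
  · rcases hR _ _ (emptyPerm_isMerge ρ) with h₂ | h₂
    · exact ⟨τ, hτ, h₂.trans (emptyPerm_contained τ), Contained.refl τ⟩
    · exact ⟨ρ, hρ, h₁, h₂⟩
  · exact ⟨σ, hσ, Contained.refl σ, h₁.trans (emptyPerm_contained σ)⟩

/-! ### Generated classes -/

/-- The closure of the empty permutation under `comb b` and under `op o y` for `y ∈ Y`. -/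
inductive Gen (b : Bool) (o : Bool × Bool) (Y : Set Permutation) : Permutation → Prop
  | empty : Gen b o Y emptyPerm
  | comb (x y : Permutation) : Gen b o Y x → Gen b o Y y → Gen b o Y (comb b x y)
  | op (y z : Permutation) : y ∈ Y → Gen b o Y z → Gen b o Y (op o y z)

/-- `Gen b o Y` as a set of permutations. -/
def genClass (b : Bool) (o : Bool × Bool) (Y : Set Permutation) : Set Permutation :=
  {π | Gen b o Y π}

lemma subset_genClass : Y ⊆ genClass b o Y := fun y hy => by
  have := Gen.op (b := b) (o := o) y emptyPerm hy Gen.empty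
  rwa [op_emptyPerm] at this

lemma genClass_subset (h0 : emptyPerm ∈ X) (hb : ∀ x ∈ X, ∀ y ∈ X, comb b x y ∈ X)
    (ho : ∀ y ∈ Y, ∀ z ∈ X, op o y z ∈ X) : genClass b o Y ⊆ X := by
  intro π hπ
  induction hπ with
  | empty => exact h0
  | comb x y _ _ hx hy => exact hb x hx y hy
  | op y z hy _ hz => exact ho y hy z hz

lemma genClass_mono {Z : Set Permutation} (h : Y ⊆ Z) : genClass b o Y ⊆ genClass b o Z :=
  genClass_subset Gen.empty (fun x hx y hy => Gen.comb x y hx hy)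
    fun y hy z hz => Gen.op y z (h hy) hz

lemma isPermClass_genClass (hY : IsPermClass Y) : IsPermClass (genClass b o Y) := by
  intro π hπ
  induction hπ with
  | empty =>
    intro σ hσ
    rw [eq_emptyPerm (Nat.le_zero.1 hσ.size_le)]
    exact Gen.empty
  | comb x y _ _ hx hy =>
    intro σ hσ
    obtain ⟨x', y', rfl, hx', hy'⟩ := hσ.exists_comb
    exact Gen.comb x' y' (hx x' hx') (hy y' hy')
  | op y z hy _ hz =>
    intro σ hσ
    obtain ⟨y', z', rfl, hy', hz'⟩ := hσ.exists_op
    exact Gen.op y' z' (hY y hy y' hy') (hz z' hz')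

lemma genClass_merge_subset {C D : Set Permutation} :
    genClass b o (merge C D) ⊆ merge (genClass b o C) (genClass b o D) := by
  refine genClass_subset (mem_merge_left Gen.empty Gen.empty)
    (comb_mem_merge (fun x hx y hy => Gen.comb x y hx hy) fun x hx y hy => Gen.comb x y hx hy) ?_
  intro y hy z hz
  obtain ⟨s, hs, t, ht, h⟩ := mem_merge.1 hy
  obtain ⟨s', hs', t', ht', h'⟩ := mem_merge.1 hz
  exact mem_merge.2 ⟨_, Gen.op s s' hs hs', _, Gen.op t t' ht ht', h.op h' o⟩

/-- Generated classes inherit primality. The Ramsey property is proved by induction on the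
generation of both permutations. -/
lemma mergePrime_genClass (hY : MergePrime Y) : MergePrime (genClass b o Y) := by
  refine mergePrime_of_exists_ramsey fun σ hσ => ?_
  induction hσ with
  | empty => exact fun τ hτ => ⟨_, Gen.empty, fun s t _ => Or.inl (emptyPerm_contained s)⟩
  | comb x y _ _ hx hy =>
    intro τ hτ
    obtain ⟨ρ₁, h₁, hρ₁⟩ := hx τ hτ
    obtain ⟨ρ₂, h₂, hρ₂⟩ := hy τ hτ
    refine ⟨_, Gen.comb ρ₁ ρ₂ h₁ h₂, fun s t hm => ?_⟩
    obtain ⟨s₁, t₁, s₂, t₂, hm₁, hm₂, hs, ht⟩ := hm.exists_of_comb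
    rcases hρ₁ _ _ hm₁ with h | h
    · rcases hρ₂ _ _ hm₂ with h' | h'
      · exact Or.inl ((h.comb h' b).trans hs)
      · exact Or.inr ((h'.trans (contained_comb_right b _ _)).trans ht)
    · exact Or.inr ((h.trans (contained_comb_left b _ _)).trans ht)
  | op y z hy hz ih =>
    intro τ hτ
    induction hτ with
    | empty => exact ⟨_, Gen.empty, fun s t _ => Or.inr (emptyPerm_contained t)⟩
    | comb u v _ _ hu hv =>
      obtain ⟨ρ₁, h₁, hρ₁⟩ := hu
      obtain ⟨ρ₂, h₂, hρ₂⟩ := hv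
      refine ⟨_, Gen.comb ρ₁ ρ₂ h₁ h₂, fun s t hm => ?_⟩
      obtain ⟨s₁, t₁, s₂, t₂, hm₁, hm₂, hs, ht⟩ := hm.exists_of_comb
      rcases hρ₁ _ _ hm₁ with h | h
      · exact Or.inl ((h.trans (contained_comb_left b _ _)).trans hs)
      · rcases hρ₂ _ _ hm₂ with h' | h'
        · exact Or.inl ((h'.trans (contained_comb_right b _ _)).trans hs)
        · exact Or.inr ((h.comb h' b).trans ht)
    | op u v hu hv ih' =>
      -- Here `r` supplies `y` in the first colour or `u` in the second one. It is combined with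
      -- Ramsey witnesses for `(z, op o u v)` and `(op o y z, v)`, which supply what is missing.
      obtain ⟨r, hr, hR⟩ := hY.exists_ramsey hy hu
      obtain ⟨ρ₁, h₁, hρ₁⟩ := ih _ (Gen.op u v hu hv)
      obtain ⟨ρ₂, h₂, hρ₂⟩ := ih'
      refine ⟨_, Gen.op r _ hr (Gen.comb ρ₁ ρ₂ h₁ h₂), fun s t hm => ?_⟩
      obtain ⟨s₀, t₀, s', t', hm₀, hm', hs, ht⟩ := hm.exists_of_op
      obtain ⟨s₁, t₁, s₂, t₂, hm₁, hm₂, hs', ht'⟩ := hm'.exists_of_comb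
      have hs'' : Contained s' s := (contained_op_right o _ _).trans hs
      have ht'' : Contained t' t := (contained_op_right o _ _).trans ht
      have hs₁ := (contained_comb_left b s₁ s₂).trans hs'
      have hs₂ := (contained_comb_right b s₁ s₂).trans hs'
      have ht₁ := (contained_comb_left b t₁ t₂).trans ht'
      have ht₂ := (contained_comb_right b t₁ t₂).trans ht'
      rcases hR _ _ hm₀ with h | h
      · rcases hρ₁ _ _ hm₁ with h' | h'
        · exact Or.inl ((h.op (h'.trans hs₁) o).trans hs)
        · exact Or.inr ((h'.trans ht₁).trans ht'')
      · rcases hρ₂ _ _ hm₂ with h' | h'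
        · exact Or.inl ((h'.trans hs₂).trans hs'')
        · exact Or.inr ((h.op (h'.trans ht₂) o).trans ht)

/-! ### Inflations -/

/-- `π` is an inflation of `σ` by members of `Y`: `f` sends each position of `π` to the position of
`σ` whose inflation it belongs to. -/
def Inflates (Y : Set Permutation) (π σ : Permutation) : Prop :=
  ∃ f : Fin π.1 → Fin σ.1, Monotone f ∧ (∀ i, ∃ τ ∈ Y, IsPatternOf τ π (f ⁻¹' {i})) ∧
    ∀ k l, f k ≠ f l → (π.2 k < π.2 l ↔ σ.2 (f k) < σ.2 (f l))

lemma mem_inflate : π ∈ inflate X Y ↔ ∃ σ ∈ X, Inflates Y π σ := by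
  constructor
  · rintro ⟨σ, hσ, τ, hτ, f, hf, hp, hv⟩
    exact ⟨σ, hσ, f, hf, fun i => ⟨τ i, hτ i, hp i⟩, hv⟩
  · rintro ⟨σ, hσ, f, hf, hp, hv⟩
    choose τ hτ hp using hp
    exact ⟨σ, hσ, τ, hτ, f, hf, hp, hv⟩

lemma IsPatternOf.unique {S : Set (Fin π.1)} (h : IsPatternOf σ π S) (h' : IsPatternOf τ π S) :
    σ = τ := by
  obtain ⟨f, hf⟩ := isPatternOf_iff.1 h
  obtain ⟨g, hg⟩ := isPatternOf_iff.1 h'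
  exact (h'.contained_of_emb f fun i => hf ▸ ⟨i, rfl⟩).antisymm
    (h.contained_of_emb g fun i => hg ▸ ⟨i, rfl⟩)

lemma inflates_emptyPerm : Inflates Y π emptyPerm ↔ π = emptyPerm := by
  constructor
  · rintro ⟨f, -⟩
    refine eq_emptyPerm (Nat.eq_zero_of_not_pos fun h => ?_)
    exact Fin.elim0 (f ⟨0, h⟩)
  · rintro rfl
    exact ⟨id, monotone_id, fun i => Fin.elim0 i, fun i => Fin.elim0 i⟩

lemma inflates_onePerm : Inflates Y π onePerm ↔ π ∈ Y := by
  have : Subsingleton (Fin onePerm.1) := inferInstanceAs (Subsingleton (Fin 1))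
  have huniv : ∀ (f : Fin π.1 → Fin onePerm.1) i, f ⁻¹' {i} = Set.univ := fun f i =>
    Set.eq_univ_of_forall fun k => Subsingleton.elim _ _
  obtain ⟨z⟩ : Nonempty (Fin onePerm.1) := ⟨(0 : Fin 1)⟩
  constructor
  · rintro ⟨f, -, hp, -⟩
    obtain ⟨τ, hτ, h⟩ := hp z
    rw [huniv f] at h
    rwa [(isPatternOf_univ π).unique h]
  · intro hπ
    refine ⟨fun _ => z, fun _ _ _ => (Subsingleton.elim _ _).le, fun i => ⟨π, hπ, ?_⟩,
      fun k l h => absurd rfl h⟩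
    rw [huniv]
    exact isPatternOf_univ π

lemma Inflates.comb {π' σ' : Permutation} (h : Inflates Y π σ) (h' : Inflates Y π' σ') (b : Bool) :
    Inflates Y (comb b π π') (comb b σ σ') := by
  obtain ⟨f, hf, hp, hv⟩ := h
  obtain ⟨g, hg, hp', hv'⟩ := h'
  let k : Fin (PermSplit.comb b π π').1 → Fin (PermSplit.comb b σ σ').1 :=
    Fin.addCases (m := π.1) (n := π'.1) (fun i => inl b σ σ' (f i)) (fun i => inr b σ σ' (g i))
  have k1 : ∀ i, k (inl b π π' i) = inl b σ σ' (f i) := fun i =>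
    Fin.addCases_left (m := π.1) (n := π'.1) i
  have k2 : ∀ i, k (inr b π π' i) = inr b σ σ' (g i) := fun i =>
    Fin.addCases_right (m := π.1) (n := π'.1) i
  refine ⟨k, fun i j => ?_, fun i => ?_, fun i j => ?_⟩
  · induction i using comb_cases with
    | hl i =>
      induction j using comb_cases with
      | hl j =>
        rw [k1, k1, (inl b π π').pos.le_iff_le, (inl b σ σ').pos.le_iff_le]
        exact fun h => hf h
      | hr j => rw [k1, k2]; exact fun _ => (inl_lt_inr _ _).le
    | hr i =>
      induction j using comb_cases with
      | hl j => exact fun h => absurd h (inl_lt_inr _ _).not_ge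
      | hr j =>
        rw [k2, k2, (inr b π π').pos.le_iff_le, (inr b σ σ').pos.le_iff_le]
        exact fun h => hg h
  · induction i using comb_cases with
    | hl i =>
      obtain ⟨τ, hτ, h⟩ := hp i
      refine ⟨τ, hτ, ?_⟩
      have : k ⁻¹' {inl b σ σ' i} = inl b π π' '' (f ⁻¹' {i}) := by
        ext l
        induction l using comb_cases with
        | hl l =>
          simp [k1, (inl b σ σ').pos.injective.eq_iff, (inl b π π').pos.injective.eq_iff]
        | hr l =>
          simp [k2, inl_ne_inr, (inl_ne_inr _ _).symm]
      rw [this]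
      exact h.image _
    | hr i =>
      obtain ⟨τ, hτ, h⟩ := hp' i
      refine ⟨τ, hτ, ?_⟩
      have : k ⁻¹' {inr b σ σ' i} = inr b π π' '' (g ⁻¹' {i}) := by
        ext l
        induction l using comb_cases with
        | hl l =>
          simp [k1, inl_ne_inr, (inl_ne_inr _ _).symm]
        | hr l =>
          simp [k2, (inr b σ σ').pos.injective.eq_iff, (inr b π π').pos.injective.eq_iff]
      rw [this]
      exact h.image _
  · induction i using comb_cases with
    | hl i =>
      induction j using comb_cases with
      | hl j =>
        rw [k1, k1, ← (inl b π π').val_iff, ← (inl b σ σ').val_iff]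
        exact fun h => hv i j fun h' => h (by rw [h'])
      | hr j =>
        rw [k1, k2]
        intro _
        have h1 := vlt_inl_inr (b := b) i j
        have h2 := vlt_inl_inr (b := b) (f i) (g j)
        cases b
        · exact iff_of_false (lt_asymm h1) (lt_asymm h2)
        · exact iff_of_true h1 h2
    | hr i =>
      induction j using comb_cases with
      | hl j =>
        rw [k1, k2]
        intro _
        have h1 := vlt_inl_inr (b := b) j i
        have h2 := vlt_inl_inr (b := b) (f j) (g i)
        cases b
        · exact iff_of_true h1 h2
        · exact iff_of_false (lt_asymm h1) (lt_asymm h2)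
      | hr j =>
        rw [k2, k2, ← (inr b π π').val_iff, ← (inr b σ σ').val_iff]
        exact fun h => hv' i j fun h' => h (by rw [h'])

/-- The part of an inflation of `ρ` that lies over the image of `e : σ → ρ` is an inflation
of `σ`. -/
lemma Inflates.of_range {f : Fin π.1 → Fin ρ.1} (hf : Monotone f)
    (hp : ∀ i, ∃ τ ∈ Y, IsPatternOf τ π (f ⁻¹' {i}))
    (hv : ∀ k l, f k ≠ f l → (π.2 k < π.2 l ↔ ρ.2 (f k) < ρ.2 (f l)))
    (e : Emb σ ρ) (g : Emb x π) (hg : Set.range g = f ⁻¹' Set.range e) : Inflates Y x σ := by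
  have hmem : ∀ i, f (g i) ∈ Set.range e := fun i => by
    have : g i ∈ Set.range g := ⟨i, rfl⟩
    rwa [hg] at this
  choose k hk using hmem
  refine ⟨k, fun i j hij => ?_, fun i => ?_, fun i j hij => ?_⟩
  · rw [← e.pos.le_iff_le, hk, hk]
    exact hf (g.pos.monotone hij)
  · obtain ⟨τ, hτ, h⟩ := hp (e i)
    refine ⟨τ, hτ, ?_⟩
    have : k ⁻¹' {i} = g ⁻¹' (f ⁻¹' {e i}) := by
      ext l
      simp [← hk, e.pos.injective.eq_iff]
    rw [this]
    refine h.preimage g ?_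
    rw [hg]
    rintro l hl
    exact ⟨i, hl.symm⟩
  · rw [g.val_iff, e.val_iff, hk, hk]
    refine hv _ _ fun h => hij (e.pos.injective ?_)
    rw [hk, hk, h]

lemma Inflates.exists_comb (h : Inflates Y π (PermSplit.comb b x y)) :
    ∃ x' y', π = PermSplit.comb b x' y' ∧ Inflates Y x' x ∧ Inflates Y y' y := by
  obtain ⟨f, hf, hp, hv⟩ := h
  have key : ∀ k, k ∈ Set.range (inl b x y) ∨ k ∈ Set.range (inr b x y) := fun k => by
    induction k using comb_cases with
    | hl i => exact Or.inl ⟨i, rfl⟩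
    | hr i => exact Or.inr ⟨i, rfl⟩
  obtain ⟨x', y', rfl, f', g', hf', hg'⟩ := exists_eq_comb b π (f ⁻¹' Set.range (inl b x y))
    (by
      rintro i ⟨i', hi⟩ j hj
      obtain ⟨j', hj⟩ := (key (f j)).resolve_left hj
      by_contra hij
      have := hf (not_lt.1 hij)
      rw [← hi, ← hj] at this
      exact this.not_gt (inl_lt_inr _ _))
    (by
      rintro i ⟨i', hi⟩ j hj
      obtain ⟨j', hj⟩ := (key (f j)).resolve_left hj
      have h := vlt_inl_inr (b := b) i' j'
      rw [hi, hj] at h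
      have hne : f i ≠ f j := by
        rw [← hi, ← hj]
        exact inl_ne_inr _ _
      cases b
      · exact (hv _ _ hne.symm).2 h
      · exact (hv _ _ hne).2 h)
  refine ⟨x', y', rfl, Inflates.of_range hf hp hv (inl b x y) f' hf',
    Inflates.of_range hf hp hv (inr b x y) g' ?_⟩
  rw [hg']
  ext k
  simp only [Set.mem_compl_iff, Set.mem_preimage]
  constructor
  · exact fun h => (key (f k)).resolve_left h
  · rintro ⟨j, hj⟩ ⟨i, hi⟩
    exact inl_ne_inr _ _ (hi.trans hj.symm)

lemma Inflates.op {π' σ' : Permutation} (h : Inflates Y π σ) (h' : Inflates Y π' σ')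
    (o : Bool × Bool) : Inflates Y (op o π π') (op o σ σ') := by
  obtain ⟨c, _ | _⟩ := o
  · exact h'.comb h c
  · exact h.comb h' c

lemma Inflates.exists_op (h : Inflates Y π (PermSplit.op o x y)) :
    ∃ x' y', π = PermSplit.op o x' y' ∧ Inflates Y x' x ∧ Inflates Y y' y := by
  obtain ⟨c, _ | _⟩ := o
  · obtain ⟨y', x', h, hy, hx⟩ := Inflates.exists_comb h
    exact ⟨x', y', h, hx, hy⟩
  · exact Inflates.exists_comb h

/-- Inflating a class generated by the permutation `1` amounts to replacing `1` by the members of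
`Y` in the generation. -/
lemma inflate_genClass (b : Bool) (o : Bool × Bool) (Y : Set Permutation) :
    inflate (genClass b o {onePerm}) Y = genClass b o Y := by
  apply Set.Subset.antisymm
  · intro π hπ
    obtain ⟨σ, hσ, h⟩ := mem_inflate.1 hπ
    clear hπ
    induction hσ generalizing π with
    | empty => rw [inflates_emptyPerm.1 h]; exact Gen.empty
    | comb u v _ _ hu hv =>
      obtain ⟨x, y, rfl, hx, hy⟩ := h.exists_comb
      exact Gen.comb x y (hu hx) (hv hy)
    | op u v hu _ hv =>
      obtain ⟨x, y, rfl, hx, hy⟩ := h.exists_op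
      rw [Set.mem_singleton_iff.1 hu, inflates_onePerm] at hx
      exact Gen.op x y hx (hv hy)
  · refine genClass_subset ?_ ?_ ?_
    · exact mem_inflate.2 ⟨_, Gen.empty, inflates_emptyPerm.2 rfl⟩
    · intro x hx y hy
      obtain ⟨σ, hσ, h⟩ := mem_inflate.1 hx
      obtain ⟨τ, hτ, h'⟩ := mem_inflate.1 hy
      exact mem_inflate.2 ⟨_, Gen.comb σ τ hσ hτ, h.comb h' b⟩
    · intro y hy z hz
      obtain ⟨σ, hσ, h⟩ := mem_inflate.1 hz
      exact mem_inflate.2 ⟨_, Gen.op onePerm σ rfl hσ, (inflates_onePerm.2 hy).op h o⟩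

/-! ### The six classes of the alphabet -/

instance {n : ℕ} (b : Bool) (i j : Fin n) : Decidable (vlt b i j) := by
  cases b
  · exact inferInstanceAs (Decidable (j < i))
  · exact inferInstanceAs (Decidable (i < j))

/-- `π` can be cut after its first `k` positions: the values before and after the cut compare as
in a sum (`b = true`) or a skew sum (`b = false`). -/
def IsCut (b : Bool) (π : Permutation) (k : ℕ) : Prop :=
  ∀ i j : Fin π.1, i.1 < k → k ≤ j.1 → vlt b (π.2 i) (π.2 j)

lemma isCut_comb (b : Bool) (x y : Permutation) : IsCut b (comb b x y) x.1 := by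
  intro i j
  induction i using comb_cases with
  | hl i =>
    induction j using comb_cases with
    | hl j => exact fun _ h => absurd h (not_le.2 j.2)
    | hr j => exact fun _ _ => vlt_inl_inr i j
  | hr i => exact fun h => absurd h (not_lt.2 (Nat.le_add_right x.1 i.1))

lemma IsCut.exists_eq_comb {k : ℕ} (h : IsCut b π k) (hk : k ≤ π.1) :
    ∃ x y, π = comb b x y ∧ x.1 = k := by
  obtain ⟨x, y, hxy, f, -, hf, -⟩ := PermSplit.exists_eq_comb b π {i | i.1 < k}
    (fun i hi j hj => Fin.lt_def.2 (lt_of_lt_of_le hi (not_lt.1 hj)))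
    (fun i hi j hj => h i j hi (not_lt.1 hj))
  refine ⟨x, y, hxy, ?_⟩
  have h1 : Nat.card (Set.range f) = Nat.card (Set.range (Fin.castLE hk)) := by
    rw [hf, Fin.range_castLE]
  rwa [Nat.card_range_of_injective f.pos.injective,
    Nat.card_range_of_injective (Fin.castLE_injective hk), Nat.card_fin, Nat.card_fin] at h1

lemma vlt_or_vlt (b : Bool) {n : ℕ} {i j : Fin n} (h : i ≠ j) : vlt b i j ∨ vlt b j i := by
  cases b
  · exact (lt_or_gt_of_ne h).symm
  · exact lt_or_gt_of_ne h

lemma vlt_not {n : ℕ} {i j : Fin n} : vlt (!b) i j ↔ vlt b j i := by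
  cases b <;> rfl

/-- The position of the maximum (`b = true`) or of the minimum (`b = false`). -/
lemma exists_vlt_extreme (b : Bool) (h : 0 < π.1) :
    ∃ p, ∀ j, j ≠ p → vlt b (π.2 j) (π.2 p) := by
  have : Nonempty (Fin π.1) := ⟨⟨0, h⟩⟩
  cases b
  · obtain ⟨p, hp⟩ := Finite.exists_min π.2
    exact ⟨p, fun j hj => (hp j).lt_of_ne fun h => hj (π.2.injective h.symm)⟩
  · obtain ⟨p, hp⟩ := Finite.exists_max π.2
    exact ⟨p, fun j hj => (hp j).lt_of_ne fun h => hj (π.2.injective h)⟩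

/-- `π` is increasing (`b = true`) or decreasing (`b = false`). -/
def IsMonotone (b : Bool) (π : Permutation) : Prop :=
  ∀ i j, i < j → vlt b (π.2 i) (π.2 j)

lemma isMonotone_eq_genClass (b : Bool) :
    {π | IsMonotone b π} = genClass b (b, true) {onePerm} := by
  apply Set.Subset.antisymm
  · intro π hπ
    induction hn : π.1 generalizing π with
    | zero => rw [eq_emptyPerm hn]; exact Gen.empty
    | succ n ih =>
      have hcut : IsCut b π 1 := fun i j hi hj => hπ i j (Fin.lt_def.2 (hi.trans_le hj))
      obtain ⟨x, y, rfl, hx⟩ := hcut.exists_eq_comb (by omega)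
      rw [eq_onePerm hx]
      refine Gen.op (o := (b, true)) onePerm y rfl (ih (fun i j hij => ?_) ?_)
      · rw [(inr b x y).vlt_iff]
        exact hπ _ _ ((inr b x y).pos hij)
      · have : x.1 + y.1 = n + 1 := hn
        omega
  · have hcomb : ∀ x ∈ {π | IsMonotone b π}, ∀ y ∈ {π | IsMonotone b π},
        comb b x y ∈ {π | IsMonotone b π} := by
      intro x hx y hy i j
      induction i using comb_cases with
      | hl i =>
        induction j using comb_cases with
        | hl j =>
          rw [(inl b x y).pos.lt_iff_lt, ← (inl b x y).vlt_iff]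
          exact hx i j
        | hr j => exact fun _ => vlt_inl_inr i j
      | hr i =>
        induction j using comb_cases with
        | hl j => exact fun h => absurd h (inl_lt_inr _ _).not_gt
        | hr j =>
          rw [(inr b x y).pos.lt_iff_lt, ← (inr b x y).vlt_iff]
          exact hy i j
    refine genClass_subset (fun i => Fin.elim0 i) hcomb fun y hy z hz => hcomb y ?_ z hz
    rw [Set.mem_singleton_iff.1 hy]
    intro i j hij
    exact absurd hij (by rw [Subsingleton.elim (α := Fin 1) i j]; exact lt_irrefl _)

/-- The absence of the pattern `231` (`b = true`) or `213` (`b = false`). -/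
def AvoidsL (b : Bool) (π : Permutation) : Prop :=
  ∀ i j k, i < j → j < k → ¬ (vlt b (π.2 k) (π.2 i) ∧ vlt b (π.2 i) (π.2 j))

/-- The absence of the pattern `312` (`b = true`) or `132` (`b = false`). -/
def AvoidsR (b : Bool) (π : Permutation) : Prop :=
  ∀ i j k, i < j → j < k → ¬ (vlt b (π.2 j) (π.2 k) ∧ vlt b (π.2 k) (π.2 i))

lemma AvoidsL.of_emb (h : AvoidsL b π) (f : Emb σ π) : AvoidsL b σ := by
  intro i j k hij hjk
  rw [f.vlt_iff, f.vlt_iff]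
  exact h _ _ _ (f.pos hij) (f.pos hjk)

lemma AvoidsR.of_emb (h : AvoidsR b π) (f : Emb σ π) : AvoidsR b σ := by
  intro i j k hij hjk
  rw [f.vlt_iff, f.vlt_iff]
  exact h _ _ _ (f.pos hij) (f.pos hjk)

/-- Cutting `π` before its extreme element `p` leaves a right part in which `p` comes first and is
also cut off by the other operation. -/
lemma AvoidsL.mem_genClass (h : AvoidsL b π) : π ∈ genClass b (!b, true) {onePerm} := by
  induction hn : π.1 using Nat.strong_induction_on generalizing π with
  | _ n ih =>
    subst hn
    rcases Nat.eq_zero_or_pos π.1 with h0 | h0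
    · rw [eq_emptyPerm h0]; exact Gen.empty
    obtain ⟨p, hp⟩ := exists_vlt_extreme b h0
    have hcut : IsCut b π p := by
      intro i j hi hj
      have hip : i < p := hi
      rcases (show p ≤ j from hj).eq_or_lt with rfl | hpj
      · exact hp i hip.ne
      · by_contra hij
        have hji := (vlt_or_vlt b fun h => (hip.trans hpj).ne (π.2.injective h)).resolve_left hij
        exact h i p j hip hpj ⟨hji, hp i hip.ne⟩
    have hp2 := p.2
    obtain ⟨x, y, rfl, hx⟩ := hcut.exists_eq_comb hp2.le
    have hsize : (comb b x y).1 = x.1 + y.1 := rfl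
    have hy : 0 < y.1 := by omega
    have hcut' : IsCut (!b) y 1 := by
      intro i j hi hj
      rw [vlt_not, (inr b x y).vlt_iff]
      have hpi : inr b x y i = p := Fin.ext (show x.1 + i.1 = p.1 by omega)
      rw [hpi]
      refine hp _ fun hpj => ?_
      have : i = j := (inr b x y).pos.injective (hpi.trans hpj.symm)
      rw [this] at hi
      omega
    obtain ⟨u, v, rfl, hu⟩ := hcut'.exists_eq_comb hy
    have hsize' : (comb (!b) u v).1 = u.1 + v.1 := rfl
    refine Gen.comb _ _ (ih _ (by omega) (h.of_emb (inl b _ _)) rfl) ?_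
    rw [eq_onePerm hu] at h ⊢
    exact Gen.op (o := (!b, true)) _ _ rfl (ih _ (by omega)
      ((h.of_emb (inr b _ _)).of_emb (inr (!b) _ _)) rfl)

/-- Cutting `π` after its extreme element `p` leaves a left part in which `p` comes last and is
also cut off by the other operation. -/
lemma AvoidsR.mem_genClass (h : AvoidsR b π) : π ∈ genClass b (!b, false) {onePerm} := by
  induction hn : π.1 using Nat.strong_induction_on generalizing π with
  | _ n ih =>
    subst hn
    rcases Nat.eq_zero_or_pos π.1 with h0 | h0
    · rw [eq_emptyPerm h0]; exact Gen.empty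
    obtain ⟨p, hp⟩ := exists_vlt_extreme (!b) h0
    simp only [vlt_not] at hp
    have hcut : IsCut b π (p + 1) := by
      intro i j hi hj
      have hpj : p < j := hj
      rcases (show i ≤ p from Nat.lt_succ_iff.1 hi).eq_or_lt with rfl | hip
      · exact hp j hpj.ne'
      · by_contra hij
        have hji := (vlt_or_vlt b fun h => (hip.trans hpj).ne (π.2.injective h)).resolve_left hij
        exact h i p j hip hpj ⟨hp j hpj.ne', hji⟩
    have hp2 := p.2
    obtain ⟨x, y, rfl, hx⟩ := hcut.exists_eq_comb hp2
    have hsize : (comb b x y).1 = x.1 + y.1 := rfl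
    have hcut' : IsCut (!b) x p.1 := by
      intro i j hi hj
      have hj2 := j.2
      rw [vlt_not, (inl b x y).vlt_iff]
      have hpi : inl b x y j = p := Fin.ext (show j.1 = p.1 by omega)
      rw [hpi]
      refine hp _ fun hpj => ?_
      have : j = i := (inl b x y).pos.injective (hpi.trans hpj.symm)
      rw [this] at hj
      omega
    obtain ⟨u, v, rfl, hu⟩ := hcut'.exists_eq_comb (by omega)
    have hsize' : (comb (!b) u v).1 = u.1 + v.1 := rfl
    refine Gen.comb _ _ ?_ (ih _ (by omega) (h.of_emb (inr b _ _)) rfl)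
    rw [eq_onePerm (show v.1 = 1 by omega)] at h ⊢
    exact Gen.op (o := (!b, false)) _ _ rfl (ih _ (by omega)
      ((h.of_emb (inl b _ _)).of_emb (inl (!b) _ _)) rfl)

lemma comb_mem_Av (hτ : ∀ k, 0 < k → k < τ.1 → ¬ IsCut b τ k) :
    ∀ x ∈ Av τ, ∀ y ∈ Av τ, comb b x y ∈ Av τ := by
  intro x hx y hy h
  obtain ⟨x', y', rfl, hx', hy'⟩ := h.exists_comb
  rcases Nat.eq_zero_or_pos x'.1 with h0 | h0
  · rw [eq_emptyPerm h0, emptyPerm_comb] at hy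
    exact hy hy'
  rcases Nat.eq_zero_or_pos y'.1 with h1 | h1
  · rw [eq_emptyPerm h1, comb_emptyPerm] at hx
    exact hx hx'
  exact hτ x'.1 h0 (Nat.lt_add_of_pos_right h1) (isCut_comb b x' y')

lemma comb_onePerm_mem_Av (hτ : ¬ IsCut b τ 1) : ∀ y ∈ Av τ, comb b onePerm y ∈ Av τ := by
  intro y hy h
  obtain ⟨x', y', rfl, hx', hy'⟩ := h.exists_comb
  rcases Nat.le_one_iff_eq_zero_or_eq_one.1 (show x'.1 ≤ 1 from hx'.size_le) with h0 | h0
  · rw [eq_emptyPerm h0, emptyPerm_comb] at hy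
    exact hy hy'
  · exact hτ (h0 ▸ isCut_comb b x' y')

lemma comb_mem_Av_onePerm (hτ : ¬ IsCut b τ (τ.1 - 1)) :
    ∀ x ∈ Av τ, comb b x onePerm ∈ Av τ := by
  intro x hx h
  obtain ⟨x', y', rfl, hx', hy'⟩ := h.exists_comb
  rcases Nat.le_one_iff_eq_zero_or_eq_one.1 (show y'.1 ≤ 1 from hy'.size_le) with h0 | h0
  · rw [eq_emptyPerm h0, comb_emptyPerm] at hx
    exact hx hx'
  · refine hτ ?_
    have : (comb b x' y').1 - 1 = x'.1 := by
      rw [show (comb b x' y').1 = x'.1 + y'.1 from rfl, h0, Nat.add_sub_cancel]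
    rw [this]
    exact isCut_comb b x' y'

lemma emptyPerm_mem_Av (hτ : 0 < τ.1) : emptyPerm ∈ Av τ := fun h =>
  absurd h.size_le (not_le.2 hτ)

/-- A pattern of size three occurs at positions `i < j < k` as soon as the values at these
positions, listed in the order prescribed by the pattern, increase. -/
lemma contained_of_three (s : Equiv.Perm (Fin 3)) {i j k : Fin π.1} (hij : i < j) (hjk : j < k)
    (h0 : π.2 (![i, j, k] (s.symm 0)) < π.2 (![i, j, k] (s.symm 1)))
    (h1 : π.2 (![i, j, k] (s.symm 1)) < π.2 (![i, j, k] (s.symm 2))) :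
    Contained ⟨3, s⟩ π := by
  have hp : StrictMono ![i, j, k] :=
    Fin.strictMono_iff_lt_succ.2 (Fin.forall_fin_two.2 ⟨hij, hjk⟩)
  have hv : StrictMono fun v => π.2 (![i, j, k] (s.symm v)) :=
    Fin.strictMono_iff_lt_succ.2 (Fin.forall_fin_two.2 ⟨h0, h1⟩)
  refine Emb.contained ⟨![i, j, k], hp, fun {a c} hac => ?_⟩
  simpa using hv hac

/-- The direction of the binary operation under which the class of a letter is closed. -/
def Letter.dir : Letter → Bool
  | .I | .av231 | .av312 => true
  | .D | .av213 | .av132 => false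

/-- The operation by which the permutation `1` may be added to a member of the class of a
letter. -/
def Letter.side : Letter → Bool × Bool
  | .I => (true, true)
  | .D => (false, true)
  | .av231 => (false, true)
  | .av312 => (false, false)
  | .av213 => (true, true)
  | .av132 => (true, false)

/-- `Av τ` is generated by `1` if `τ` has no cuts that would let it arise in the generation. -/
lemma Av_eq_genClass (b s : Bool) (h0 : 0 < τ.1) (h1 : ∀ k, 0 < k → k < τ.1 → ¬ IsCut b τ k)
    (h2 : ¬ IsCut (!b) τ (bif s then 1 else τ.1 - 1))
    (h3 : ∀ π ∈ Av τ, π ∈ genClass b (!b, s) {onePerm}) :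
    Av τ = genClass b (!b, s) {onePerm} := by
  refine Set.Subset.antisymm h3 (genClass_subset (emptyPerm_mem_Av h0) (comb_mem_Av h1) ?_)
  rintro y rfl
  cases s
  · exact comb_mem_Av_onePerm h2
  · exact comb_onePerm_mem_Av h2

instance (b : Bool) (π : Permutation) (k : ℕ) : Decidable (IsCut b π k) := by
  unfold IsCut
  infer_instance

lemma not_isCut (τ : Permutation) (h3 : τ.1 = 3) (h1 : ¬ IsCut b τ 1) (h2 : ¬ IsCut b τ 2) :
    ∀ k, 0 < k → k < τ.1 → ¬ IsCut b τ k := by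
  intro k hk hk'
  rcases (show k = 1 ∨ k = 2 by omega) with rfl | rfl
  · exact h1
  · exact h2

lemma Letter.toClass_eq_genClass (a : Letter) : a.toClass = genClass a.dir a.side {onePerm} := by
  cases a
  case I =>
    exact isMonotone_eq_genClass true
  case D =>
    exact isMonotone_eq_genClass false
  case av213 =>
    exact Av_eq_genClass false true (Nat.succ_pos 2) (not_isCut _ rfl (by decide) (by decide))
      (by decide) fun π hπ => AvoidsL.mem_genClass fun i j k hij hjk h =>
        hπ (contained_of_three _ hij hjk h.2 h.1)
  case av312 =>
    exact Av_eq_genClass true false (Nat.succ_pos 2) (not_isCut _ rfl (by decide) (by decide))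
      (by decide) fun π hπ => AvoidsR.mem_genClass fun i j k hij hjk h =>
        hπ (contained_of_three _ hij hjk h.1 h.2)
  case av132 =>
    exact Av_eq_genClass false false (Nat.succ_pos 2) (not_isCut _ rfl (by decide) (by decide))
      (by decide) fun π hπ => AvoidsR.mem_genClass fun i j k hij hjk h =>
        hπ (contained_of_three _ hij hjk h.2 h.1)
  case av231 =>
    exact Av_eq_genClass true true (Nat.succ_pos 2) (not_isCut _ rfl (by decide) (by decide))
      (by decide) fun π hπ => AvoidsL.mem_genClass fun i j k hij hjk h =>
        hπ (contained_of_three _ hij hjk h.1 h.2)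

lemma wordClass_cons (a : Letter) (w : List Letter) :
    wordClass (a :: w) = genClass a.dir a.side (wordClass w) := by
  change inflate a.toClass (wordClass w) = _
  rw [a.toClass_eq_genClass, inflate_genClass]

/-! ### Separable permutations are well-quasi-ordered -/

instance : IsPreorder Permutation Contained where
  refl := Contained.refl
  trans _ _ _ := Contained.trans

lemma comb_mem_Sep (b : Bool) (hx : x ∈ Sep) (hy : y ∈ Sep) : comb b x y ∈ Sep := by
  cases b
  · exact IsSeparable.skew x y hx hy
  · exact IsSeparable.sum x y hx hy

lemma Sep_induction {P : Permutation → Prop} (h0 : P emptyPerm) (h1 : P onePerm)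
    (hc : ∀ b x y, P x → P y → P (comb b x y)) (hπ : π ∈ Sep) : P π := by
  induction (show IsSeparable π from hπ) with
  | empty => exact h0
  | one => exact h1
  | sum x y hx hy ihx ihy => exact hc true x y (ihx hx) (ihy hy)
  | skew x y hx hy ihx ihy => exact hc false x y (ihx hx) (ihy hy)

/-- The constructors of `Sep` may be used with nonempty summands only. -/
lemma exists_smaller_of_mem_Sep (hπ : π ∈ Sep) (hsize : 1 < π.1) :
    ∃ b, ∃ x ∈ Sep, ∃ y ∈ Sep, π = comb b x y ∧ x.1 < π.1 ∧ y.1 < π.1 := by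
  suffices h : π ∈ Sep ∧ (1 < π.1 →
      ∃ b, ∃ x ∈ Sep, ∃ y ∈ Sep, π = comb b x y ∧ x.1 < π.1 ∧ y.1 < π.1) from h.2 hsize
  refine Sep_induction (P := fun π => π ∈ Sep ∧ (1 < π.1 →
      ∃ b, ∃ x ∈ Sep, ∃ y ∈ Sep, π = comb b x y ∧ x.1 < π.1 ∧ y.1 < π.1)) ?_ ?_ ?_ hπ
  · exact ⟨IsSeparable.empty, fun h => absurd h (by decide)⟩
  · exact ⟨IsSeparable.one, fun h => absurd h (by decide)⟩
  · rintro b x y ⟨hx, hx'⟩ ⟨hy, hy'⟩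
    refine ⟨comb_mem_Sep b hx hy, fun h => ?_⟩
    have hs : (comb b x y).1 = x.1 + y.1 := rfl
    rcases Nat.eq_zero_or_pos x.1 with h0 | h0
    · rw [eq_emptyPerm h0, emptyPerm_comb] at h ⊢
      exact hy' h
    rcases Nat.eq_zero_or_pos y.1 with h1 | h1
    · rw [eq_emptyPerm h1, comb_emptyPerm] at h ⊢
      exact hx' h
    exact ⟨b, x, hx, y, hy, rfl, by omega, by omega⟩

/-- The separable permutations are well-quasi-ordered by containment: in a minimal bad sequence
the summands of the terms would be well-quasi-ordered, hence so would the terms. -/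
lemma partiallyWellOrderedOn_Sep : Sep.PartiallyWellOrderedOn Contained := by
  rw [Set.PartiallyWellOrderedOn.iff_not_exists_isMinBadSeq (fun π : Permutation => π.1)]
  rintro ⟨f, ⟨hf, hbad⟩, hmin⟩
  have hpos : ∀ n, 0 < (f n).1 := fun n => Nat.pos_of_ne_zero fun h => by
    refine hbad n (n + 1) n.lt_succ_self ?_
    rw [eq_emptyPerm h]
    exact emptyPerm_contained _
  have hone : ∀ n, 1 < (f n).1 := fun n => (Nat.succ_le_of_lt (hpos n)).lt_of_ne fun h => by
    refine hbad n (n + 1) n.lt_succ_self ?_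
    rw [eq_onePerm h.symm]
    exact onePerm_contained (hpos _)
  choose b x hx y hy hxy hxs hys using fun n => exists_smaller_of_mem_Sep (hf n) (hone n)
  let S : Set Permutation := Set.range x ∪ Set.range y
  have hS : ∀ z ∈ S, ∃ n, z ∈ Sep ∧ Contained z (f n) ∧ z.1 < (f n).1 := by
    rintro z (⟨n, rfl⟩ | ⟨n, rfl⟩)
    · exact ⟨n, hx n, by rw [hxy n]; exact contained_comb_left _ _ _, hxs n⟩
    · exact ⟨n, hy n, by rw [hxy n]; exact contained_comb_right _ _ _, hys n⟩
  have hSpwo : S.PartiallyWellOrderedOn Contained := by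
    rw [Set.PartiallyWellOrderedOn.iff_forall_not_isBadSeq]
    rintro g ⟨hg, hgbad⟩
    choose m hmS hm hms using fun k => hS (g k) (hg k)
    -- Replace the tail of `f` from the earliest term that `g` refers to by a tail of `g`.
    obtain ⟨k₀, hk₀⟩ : ∃ k₀, ∀ k, m k₀ ≤ m k :=
      ⟨Function.argmin m, fun k => Function.argmin_le m k⟩
    refine hmin (m k₀) (fun n => if n < m k₀ then f n else g (k₀ + (n - m k₀)))
      (fun n hn => (if_pos hn).symm) (by simpa using hms k₀) ⟨fun n => ?_, fun i j hij => ?_⟩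
    · dsimp only
      split_ifs
      · exact hf n
      · exact hmS _
    · dsimp only
      split_ifs with hi hj hj
      · exact hbad i j hij
      · exact fun h => hbad i _ (hi.trans_le (hk₀ _)) (h.trans (hm _))
      · omega
      · exact hgbad _ _ (by omega)
  have hprod := ((Set.toFinite (Set.univ : Set Bool)).partiallyWellOrderedOn (r := Eq)).prod
    (hSpwo.prod hSpwo)
  obtain ⟨i, j, hij, h3, h1, h2⟩ := hprod.exists_lt (f := fun n => (b n, x n, y n))
    fun n => ⟨Set.mem_univ _, Or.inl ⟨n, rfl⟩, Or.inr ⟨n, rfl⟩⟩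
  refine hbad i j hij ?_
  rw [hxy i, hxy j, show b i = b j from h3]
  exact Contained.comb h1 h2 _

/-- A nonempty family of subclasses of `Sep` has a minimal member: picking an element from each
difference in a strictly descending chain of classes would give a bad sequence. -/
lemma exists_minimal_class (F : Set (Set Permutation)) (hF : F.Nonempty)
    (hcl : ∀ Y ∈ F, IsPermClass Y ∧ Y ⊆ Sep) : ∃ Y ∈ F, ∀ Z ∈ F, Z ⊆ Y → Y ⊆ Z := by
  by_contra! hne
  choose! g hgF hg hg' using hne
  obtain ⟨Y₀, hY₀⟩ := hF
  let c : ℕ → Set Permutation := fun n => g^[n] Y₀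
  have hc : ∀ n, c (n + 1) = g (c n) := fun n => Function.iterate_succ_apply' g n Y₀
  have hcF : ∀ n, c n ∈ F := fun n => by
    induction n with
    | zero => exact hY₀
    | succ n ih => rw [hc]; exact hgF _ ih
  have hanti : Antitone c := antitone_nat_of_succ_le fun n => by
    rw [hc]; exact hg _ (hcF n)
  choose z hz hz' using fun n => Set.not_subset.1 (hg' (c n) (hcF n))
  obtain ⟨i, j, hij, h⟩ := partiallyWellOrderedOn_Sep.exists_lt (f := z)
    fun n => (hcl _ (hcF n)).2 (hz n)
  refine hz' i ?_
  rw [← hc]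
  exact (hcl _ (hcF _)).1 _ (hanti (Nat.succ_le_of_lt hij) (hz j)) _ h

/-! ### Unsplittable classes of separable permutations -/

/-- A permutation that is composed of members of `Av α` by `comb b`, and does not contain
`comb b α α`, splits into only three members of `Av α`: two neighbouring parts can be joined
unless their combination contains `α`. -/
lemma exists_three_of_mem_genClass {α : Permutation} (h0 : emptyPerm ∈ Av α)
    (hπ : π ∈ genClass b (b, true) (Av α)) (hα : ¬ Contained (comb b α α) π) :
    ∃ u ∈ Av α, ∃ v ∈ Av α, ∃ w ∈ Av α, π = comb b u (comb b v w) := by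
  have key : ∀ x y, ¬ Contained (comb b α α) (comb b x y) → x ∈ Av α ∨ y ∈ Av α := by
    intro x y h
    by_contra! hxy
    exact h ((not_not.1 hxy.1).comb (not_not.1 hxy.2) b)
  have hcomb : ∀ x y, (¬ Contained (comb b α α) x →
        ∃ u ∈ Av α, ∃ v ∈ Av α, ∃ w ∈ Av α, x = comb b u (comb b v w)) →
      (¬ Contained (comb b α α) y →
        ∃ u ∈ Av α, ∃ v ∈ Av α, ∃ w ∈ Av α, y = comb b u (comb b v w)) →
      ¬ Contained (comb b α α) (comb b x y) →
        ∃ u ∈ Av α, ∃ v ∈ Av α, ∃ w ∈ Av α, comb b x y = comb b u (comb b v w) := by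
    intro x y hx hy h
    rcases key x y h with hx' | hy'
    · obtain ⟨u, hu, v, hv, w, hw, rfl⟩ := hy fun h' => h (h'.trans (contained_comb_right b _ _))
      rw [← comb_assoc] at h ⊢
      rcases key _ _ h with h1 | h1
      · exact ⟨_, h1, v, hv, w, hw, rfl⟩
      · exact ⟨x, hx', u, hu, _, h1, comb_assoc b _ _ _⟩
    · obtain ⟨u, hu, v, hv, w, hw, rfl⟩ := hx fun h' => h (h'.trans (contained_comb_left b _ _))
      rw [← comb_assoc, comb_assoc] at h ⊢
      rcases key _ _ h with h1 | h1
      · exact ⟨_, h1, w, hw, y, hy', rfl⟩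
      · exact ⟨u, hu, v, hv, _, h1, comb_assoc b _ _ _⟩
  induction hπ with
  | empty =>
    exact ⟨_, h0, _, h0, _, h0, by simp only [comb_emptyPerm]⟩
  | comb x y _ _ hx hy => exact hcomb x y hx hy hα
  | op y z hy _ hz =>
    exact hcomb y z (fun _ => ⟨y, hy, _, h0, _, h0, by simp only [comb_emptyPerm]⟩) hz hα

/-- A prime subclass of `Sep` with a member of size at least two is closed under sums or under
skew sums. -/
lemma MergePrime.exists_closed (hp : MergePrime X) (hX : IsPermClass X) (hSep : X ⊆ Sep)
    (hbig : ∃ π ∈ X, ¬ Contained π onePerm) :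
    ∃ b, ∀ x ∈ X, ∀ y ∈ X, comb b x y ∈ X := by
  by_contra! hne
  choose u hu v hv huv using hne
  obtain ⟨β, hβ, hβ1⟩ := hbig
  obtain ⟨α₁, h₁, hut, hvt⟩ := hp.exists_upper (hu true) (hv true)
  obtain ⟨α₂, h₂, huf, hvf⟩ := hp.exists_upper (hu false) (hv false)
  obtain ⟨α₃, h₃, h13, h23⟩ := hp.exists_upper h₁ h₂
  obtain ⟨α, hα, h3, hβα⟩ := hp.exists_upper h₃ hβ
  have hαα : ∀ b, comb b α α ∉ X := by
    rintro (_ | _) h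
    · exact huv false (hX _ h _ ((huf.trans (h23.trans h3)).comb (hvf.trans (h23.trans h3)) _))
    · exact huv true (hX _ h _ ((hut.trans (h13.trans h3)).comb (hvt.trans (h13.trans h3)) _))
  have h1 : onePerm ∈ Av α := fun h => hβ1 (hβα.trans h)
  have h0 : emptyPerm ∈ Av α := isPermClass_Av α _ h1 _ (emptyPerm_contained _)
  let G : Bool → Set Permutation := fun b => genClass b (b, true) (Av α)
  have hGclass : ∀ b, IsPermClass (G b) := fun b => isPermClass_genClass (isPermClass_Av α)
  have hGcomb : ∀ b, ∀ x ∈ G b, ∀ y ∈ G b, comb b x y ∈ G b := fun b x hx y hy =>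
    Gen.comb x y hx hy
  have hAvG : ∀ b, Av α ⊆ G b := fun b => subset_genClass
  -- In each step of the construction of a member of `X`, one of the two parts avoids `α`.
  have hcover : X ⊆ merge (G true) (G false) := by
    intro π hπ
    refine Sep_induction (P := fun π => π ∈ X → π ∈ merge (G true) (G false)) ?_ ?_ ?_
      (hSep hπ) hπ
    · exact fun _ => mem_merge_left Gen.empty Gen.empty
    · exact fun _ => mem_merge_left Gen.empty (hAvG true h1)
    · intro b x y ihx ihy hxy
      have hx := ihx (hX _ hxy _ (contained_comb_left b x y))
      have hy := ihy (hX _ hxy _ (contained_comb_right b x y))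
      have hG : ∀ o : Bool × Bool, ∀ x ∈ Av α, ∀ z ∈ merge (G true) (G false),
          op o x z ∈ merge (G true) (G false) := by
        rintro ⟨_ | _, _ | _⟩ x hx
        · exact op_mem_merge_right fun z hz => hGcomb false z hz x (hAvG _ hx)
        · exact op_mem_merge_right fun z hz => hGcomb false x (hAvG _ hx) z hz
        · exact op_mem_merge_left fun z hz => hGcomb true z hz x (hAvG _ hx)
        · exact op_mem_merge_left fun z hz => hGcomb true x (hAvG _ hx) z hz
      by_cases hxα : x ∈ Av α
      · exact hG (b, true) x hxα y hy
      by_cases hyα : y ∈ Av α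
      · exact hG (b, false) y hyα x hx
      · exact absurd (hX _ hxy _ ((not_not.1 hxα).comb (not_not.1 hyα) b)) (hαα b)
  have hG : ∀ b, ¬ X ⊆ G b := by
    intro b hb
    have h3 : X ⊆ merge (Av α) (merge (Av α) (Av α)) := by
      intro π hπ
      obtain ⟨u, hu, v, hv, w, hw, rfl⟩ := exists_three_of_mem_genClass h0 (hb hπ)
        fun h => hαα b (hX _ hπ _ h)
      exact op_mem_merge (b, true) hu (op_mem_merge (b, true) hv hw)
    have hc := isPermClass_Av α
    have : X ⊆ Av α := by
      rcases hp _ _ hc (isPermClass_merge hc hc) h3 with h | h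
      · exact h
      · exact (hp _ _ hc hc h).elim id id
    exact this hα (Contained.refl α)
  exact (hp _ _ (hGclass true) (hGclass false) hcover).elim (hG true) (hG false)

/-- A prime class that is closed under `comb b`, and not under the other operation, is generated
by a proper subclass. -/
lemma MergePrime.exists_eq_genClass (hp : MergePrime X) (hX : IsPermClass X) (hSep : X ⊂ Sep)
    (hone : onePerm ∈ X) (hb : ∀ x ∈ X, ∀ y ∈ X, comb b x y ∈ X) :
    ∃ o ∈ ({(b, true), (!b, true), (!b, false)} : Set (Bool × Bool)), ∃ Y ⊂ X,
      IsPermClass Y ∧ X = genClass b o Y := by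
  have hempty : emptyPerm ∈ X := hX _ hone _ (emptyPerm_contained _)
  obtain ⟨u, hu, v, hv, huv⟩ : ∃ u ∈ X, ∃ v ∈ X, comb (!b) u v ∉ X := by
    by_contra! hne
    refine hSep.2 fun π hπ => Sep_induction (P := (· ∈ X)) hempty hone ?_ hπ
    intro c x y hx hy
    rcases Bool.eq_or_eq_not c b with rfl | rfl
    · exact hb x hx y hy
    · exact hne x hx y hy
  -- `N s τ` are the members of `X` that may be combined with `τ`.
  let N : Bool → Permutation → Set Permutation := fun s τ => {y ∈ X | op (!b, s) y τ ∈ X}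
  have hN : ∀ s τ, IsPermClass (N s τ) := fun s τ y hy y' h =>
    ⟨hX y hy.1 y' h, hX _ hy.2 _ (h.op (Contained.refl τ) _)⟩
  have hNanti : ∀ s τ τ', Contained τ τ' → N s τ' ⊆ N s τ := fun s τ τ' h y hy =>
    ⟨hy.1, hX _ hy.2 _ ((Contained.refl y).op h _)⟩
  -- As `N s` is antitone and `X` is directed, a minimal `N s τ` is the least one: what may be
  -- combined with `τ` may be combined with every member of `X`.
  have hτ : ∀ s, ∃ τ ∈ X, ∀ y ∈ N s τ, ∀ x ∈ X, y ∈ N s x := by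
    intro s
    obtain ⟨_, ⟨τ, hτ, rfl⟩, hmin⟩ := exists_minimal_class (N s '' X) ⟨_, _, hempty, rfl⟩ (by
      rintro _ ⟨τ, -, rfl⟩
      exact ⟨hN s τ, fun y hy => hSep.1 hy.1⟩)
    refine ⟨τ, hτ, fun y hy x hx => ?_⟩
    exact hNanti s _ _ (contained_comb_left b x τ) (hmin _ ⟨_, hb x hx τ hτ, rfl⟩
      (hNanti s _ _ (contained_comb_right b x τ)) hy)
  choose τ hτX hτ using hτ
  -- The summand `comb b 1 1` below makes the size of `α` at least two.
  obtain ⟨α, hα, hu', hv', hτ', h1⟩ : ∃ α ∈ X, Contained u α ∧ Contained v α ∧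
      (∀ s, Contained (τ s) α) ∧ onePerm ∈ Av α := by
    refine ⟨comb b (comb b u v) (comb b (comb b (τ true) (τ false)) (comb b onePerm onePerm)),
      hb _ (hb _ hu _ hv) _ (hb _ (hb _ (hτX _) _ (hτX _)) _ (hb _ hone _ hone)),
      (contained_comb_left b u v).trans (contained_comb_left b _ _),
      (contained_comb_right b u v).trans (contained_comb_left b _ _), ?_, fun h => ?_⟩
    · rintro (_ | _)
      · exact ((contained_comb_right b _ _).trans (contained_comb_left b _ _)).trans
          (contained_comb_right b _ _)
      · exact ((contained_comb_left b _ _).trans (contained_comb_left b _ _)).trans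
          (contained_comb_right b _ _)
    · have := (((contained_comb_right b _ _).trans (contained_comb_right b _ _)).trans h).size_le
      exact absurd this (show ¬ 1 + 1 ≤ 1 by decide)
  have hαα : comb (!b) α α ∉ X := fun h => huv (hX _ h _ (hu'.comb hv' _))
  have hproper : ∀ Z, Z ∩ (Av α ∩ X) ⊂ X := fun Z =>
    ⟨fun z hz => hz.2.2, fun h => (h hα).2.1 (Contained.refl α)⟩
  have hVX : IsPermClass (Av α ∩ X) := (isPermClass_Av α).inter hX
  let W : Bool → Set Permutation := fun s => N s (τ s) ∩ (Av α ∩ X)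
  have hWclass : ∀ s, IsPermClass (W s) := fun s => (hN s (τ s)).inter hVX
  let R : Bool → Set Permutation := fun s => genClass b (!b, s) (W s)
  let G : Set Permutation := genClass b (b, true) (Av α ∩ X)
  have hRclass : ∀ s, IsPermClass (R s) := fun s => isPermClass_genClass (hWclass s)
  have hGclass : IsPermClass G := isPermClass_genClass hVX
  have hcombR : ∀ s, ∀ x ∈ R s, ∀ y ∈ R s, comb b x y ∈ R s := fun s x hx y hy =>
    Gen.comb x y hx hy
  have hcombG : ∀ x ∈ G, ∀ y ∈ G, comb b x y ∈ G := fun x hx y hy => Gen.comb x y hx hy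
  let M : Set Permutation := merge (R true) (merge (R false) (merge G G))
  have hGM : merge G G ⊆ M := fun z hz =>
    mem_merge_right Gen.empty (mem_merge_right Gen.empty hz)
  have hcover : X ⊆ M := by
    intro π hπ
    refine Sep_induction (P := fun π => π ∈ X → π ∈ M) ?_ ?_ ?_ (hSep.1 hπ) hπ
    · exact fun _ => hGM (mem_merge_left Gen.empty Gen.empty)
    · exact fun _ => hGM (mem_merge_left Gen.empty (subset_genClass ⟨h1, hone⟩))
    · intro c x y ihx ihy hxy
      have hxX := hX _ hxy _ (contained_comb_left c x y)
      have hyX := hX _ hxy _ (contained_comb_right c x y)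
      rcases Bool.eq_or_eq_not c b with rfl | rfl
      · exact comb_mem_merge (hcombR _) (comb_mem_merge (hcombR _)
          (comb_mem_merge hcombG hcombG)) x (ihx hxX) y (ihy hyX)
      · -- The part `x` avoids `α`; either it may be combined with all of `X`, or `z` avoids `α`.
        have key : ∀ s, ∀ x ∈ Av α ∩ X, ∀ z ∈ M, z ∈ X → op (!b, s) x z ∈ X →
            op (!b, s) x z ∈ M := by
          intro s x hx z hz hzX hxz
          by_cases hxN : x ∈ N s (τ s)
          · have hR : ∀ z ∈ R s, op (!b, s) x z ∈ R s := fun z hz =>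
              Gen.op x z ⟨hxN, hx⟩ hz
            cases s
            · exact op_mem_merge_right (op_mem_merge_left hR) z hz
            · exact op_mem_merge_left hR z hz
          · have hzα : z ∈ Av α := fun h => hxN ⟨hx.2, hX _ hxz _
              ((Contained.refl x).op ((hτ' s).trans h) _)⟩
            exact hGM (op_mem_merge _ (subset_genClass hx) (subset_genClass ⟨hzα, hzX⟩))
        by_cases hxα : x ∈ Av α
        · exact key true x ⟨hxα, hxX⟩ y (ihy hyX) hyX hxy
        by_cases hyα : y ∈ Av α
        · exact key false y ⟨hyα, hyX⟩ x (ihx hxX) hxX hxy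
        · exact absurd (hX _ hxy _ ((not_not.1 hxα).comb (not_not.1 hyα) _)) hαα
  have hRX : ∀ s, R s ⊆ X := fun s => genClass_subset hempty hb fun y hy z hz =>
    (hτ s y hy.1 z hz).2
  have hGX : G ⊆ X := genClass_subset hempty hb fun y hy z hz => hb y hy.2 z hz
  have hfinR : ∀ s, X ⊆ R s → ∃ o ∈ ({(b, true), (!b, true), (!b, false)} : Set (Bool × Bool)),
      ∃ Y ⊂ X, IsPermClass Y ∧ X = genClass b o Y := fun s h =>
    ⟨(!b, s), by cases s <;> simp, W s, hproper _, hWclass s, h.antisymm (hRX s)⟩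
  have hfinG : X ⊆ G → ∃ o ∈ ({(b, true), (!b, true), (!b, false)} : Set (Bool × Bool)),
      ∃ Y ⊂ X, IsPermClass Y ∧ X = genClass b o Y := fun h =>
    ⟨(b, true), by simp, Av α ∩ X, by simpa using hproper Set.univ, hVX, h.antisymm hGX⟩
  have hGG := isPermClass_merge hGclass hGclass
  rcases hp _ _ (hRclass true) (isPermClass_merge (hRclass false) hGG) hcover with h | h
  · exact hfinR true h
  rcases hp _ _ (hRclass false) hGG h with h | h
  · exact hfinR false h
  · exact hfinG ((hp _ _ hGclass hGclass h).elim id id)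

/-- For each of the admissible generation schemes there is a letter; the case `o = (b, false)`, not
listed here, would give the same class as `(b, true)`. -/
lemma exists_letter (b : Bool) (o : Bool × Bool)
    (ho : o ∈ ({(b, true), (!b, true), (!b, false)} : Set (Bool × Bool))) :
    ∃ a : Letter, a.dir = b ∧ a.side = o := by
  rcases ho with rfl | rfl | rfl <;> cases b
  · exact ⟨.D, rfl, rfl⟩
  · exact ⟨.I, rfl, rfl⟩
  · exact ⟨.av213, rfl, rfl⟩
  · exact ⟨.av231, rfl, rfl⟩
  · exact ⟨.av132, rfl, rfl⟩
  · exact ⟨.av312, rfl, rfl⟩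

/-- If a prime class is generated by a class `Y`, then it is generated by a prime subclass of `Y`,
namely by a minimal generating one: `genClass b o (C ⊙ D)` lies in the merge of `genClass b o C` and
`genClass b o D`. -/
lemma MergePrime.exists_prime_generator (hp : MergePrime X) (hSep : X ⊆ Sep)
    (hY : IsPermClass Y) (hXY : X = genClass b o Y) :
    ∃ Z ⊆ Y, IsPermClass Z ∧ MergePrime Z ∧ X = genClass b o Z := by
  obtain ⟨Z, ⟨hZY, hZ, hXZ⟩, hmin⟩ :=
    exists_minimal_class {Z | Z ⊆ Y ∧ IsPermClass Z ∧ X = genClass b o Z} ⟨Y, subset_rfl, hY, hXY⟩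
      fun Z hZ => ⟨hZ.2.1, fun z hz => hSep (hZ.2.2 ▸ subset_genClass hz)⟩
  have hle : ∀ C, IsPermClass C → X ⊆ genClass b o (C ∩ Z) → Z ⊆ C := by
    intro C hC h
    have := hmin (C ∩ Z) ⟨fun z hz => hZY hz.2, hC.inter hZ, h.antisymm (by
      rw [hXZ]; exact genClass_mono Set.inter_subset_right)⟩ Set.inter_subset_right
    exact fun z hz => (this hz).1
  refine ⟨Z, hZY, hZ, fun C D hC hD hZCD => ?_, hXZ⟩
  have hZ' : Z ⊆ merge (C ∩ Z) (D ∩ Z) := by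
    intro π hπ
    obtain ⟨s, hs, t, ht, hm⟩ := mem_merge.1 (hZCD hπ)
    exact mem_merge.2 ⟨s, ⟨hs, hZ π hπ s hm.contained_left⟩, t,
      ⟨ht, hZ π hπ t hm.contained_right⟩, hm⟩
  have hX' : X ⊆ merge (genClass b o (C ∩ Z)) (genClass b o (D ∩ Z)) := by
    rw [hXZ]
    exact (genClass_mono hZ').trans genClass_merge_subset
  exact (hp _ _ (isPermClass_genClass (hC.inter hZ)) (isPermClass_genClass (hD.inter hZ))
    hX').imp (hle C hC) (hle D hD)

lemma eq_classUnit (hX : IsPermClass X) (hone : onePerm ∈ X)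
    (h : ∀ π ∈ X, Contained π onePerm) : X = classUnit := by
  apply Set.Subset.antisymm
  · intro π hπ
    rcases Nat.le_one_iff_eq_zero_or_eq_one.1 (show π.1 ≤ 1 from (h π hπ).size_le) with h' | h'
    · exact Or.inl (eq_emptyPerm h')
    · exact Or.inr (eq_onePerm h')
  · rintro π (rfl | rfl)
    · exact hX _ hone _ (emptyPerm_contained _)
    · exact hone

lemma mergePrime_classUnit : MergePrime classUnit := by
  refine mergePrime_of_exists_ramsey fun σ hσ τ hτ => ?_
  refine ⟨onePerm, Or.inr rfl, fun s t hm => ?_⟩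
  have hle : ∀ σ ∈ classUnit, Contained σ onePerm := by
    rintro σ (rfl | rfl)
    · exact emptyPerm_contained _
    · exact Contained.refl _
  obtain ⟨S, hs, ht⟩ := hm
  let z : Fin onePerm.1 := (0 : Fin 1)
  let e : Emb onePerm onePerm := Emb.refl _
  have hz : ∀ i : Fin onePerm.1, i = z := fun i => Subsingleton.elim (α := Fin 1) i z
  by_cases hzS : z ∈ S
  · exact Or.inl ((hle σ hσ).trans (hs.contained_of_emb e fun i => by rw [hz (e i)]; exact hzS))
  · exact Or.inr ((hle τ hτ).trans (ht.contained_of_emb e fun i => by rw [hz (e i)]; exact hzS))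

lemma mergePrime_wordClass (w : List Letter) : MergePrime (wordClass w) := by
  induction w with
  | nil => exact mergePrime_classUnit
  | cons a w ih =>
    rw [wordClass_cons]
    exact mergePrime_genClass ih

/-- Prime classes of separable permutations, other than `Sep`, are representable: such a class is
generated by a smaller prime class, and descending chains of classes terminate. -/
lemma MergePrime.representable (hp : MergePrime X) (hX : IsPermClass X) (hSep : X ⊂ Sep)
    (hone : onePerm ∈ X) : Representable X := by
  by_contra hrep
  obtain ⟨X, ⟨hp, hX, hSep, hone, hrep⟩, hmin⟩ := exists_minimal_class
    {X | MergePrime X ∧ IsPermClass X ∧ X ⊂ Sep ∧ onePerm ∈ X ∧ ¬ Representable X}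
    ⟨X, hp, hX, hSep, hone, hrep⟩ fun X hX => ⟨hX.2.1, hX.2.2.1.1⟩
  by_cases hbig : ∃ π ∈ X, ¬ Contained π onePerm
  · obtain ⟨b, hb⟩ := hp.exists_closed hX hSep.1 hbig
    obtain ⟨o, ho, Y, hYX, hY, hXY⟩ := hp.exists_eq_genClass hX hSep hone hb
    obtain ⟨Z, hZY, hZ, hZp, hXZ⟩ := hp.exists_prime_generator hSep.1 hY hXY
    have hZX : Z ⊂ X := hZY.trans_ssubset hYX
    have hZone : onePerm ∈ Z := by
      by_contra h
      have hZ0 : ∀ z ∈ Z, z = emptyPerm := fun z hz => eq_emptyPerm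
        (Nat.eq_zero_of_not_pos fun h' => h (hZ z hz _ (onePerm_contained h')))
      have : genClass b o Z ⊆ {emptyPerm} := by
        refine genClass_subset rfl ?_ ?_
        · rintro x rfl y rfl
          exact comb_emptyPerm b _
        · rintro y hy z rfl
          rw [hZ0 y hy]
          exact op_emptyPerm o _
      rw [hXZ] at hone
      exact absurd (congrArg Sigma.fst (this hone)) Nat.one_ne_zero
    refine hZX.2 (hmin Z ⟨hZp, hZ, hZX.trans hSep, hZone, ?_⟩ hZX.1)
    rintro ⟨w, rfl⟩
    obtain ⟨a, rfl, rfl⟩ := exists_letter b o ho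
    exact hrep ⟨a :: w, by rw [wordClass_cons]; exact hXZ⟩
  · push Not at hbig
    exact hrep ⟨[], eq_classUnit hX hone hbig⟩

end PermSplit

theorem mainTheorem1 (X : Set PermSplit.Permutation) (hX : PermSplit.IsPermClass X)
    (hSep : X ⊂ PermSplit.Sep) (hone : PermSplit.onePerm ∈ X) :
    ¬ PermSplit.Splittable X ↔ PermSplit.Representable X := by
  rw [PermSplit.not_splittable_iff hX hone]
  constructor
  · exact fun h => h.representable hX hSep hone
  · rintro ⟨w, rfl⟩
    exact PermSplit.mergePrime_wordClass w
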